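/- Let $R$ be a (commutative, Noetherian) Cohen–Macaulay local ring of Krull dimension $d$ having a canonical module $\omega$, i.e. a maximal Cohen–Macaulay $R$-module of type $1$ and of finite injective dimension. For an $R$-module $X$ write $X^\dagger=\operatorname{Hom}_R(X,\omega)$. Here a Cohen–Macaulay module is a nonzero finitely generated module $X$ with $\operatorname{depth}X=\dim X$, and it is maximal Cohen–Macaulay if moreover $\dim X=\dim R$; $\operatorname{Ext}^i_R$ with $i<0$ is zero. Let $M$ and $N$ be finitely generated $R$-modules with $N$ maximal Cohen–Macaulay, and let $n\ge 0$ be an integer. (i) If $\operatorname{Ext}^j_R(M,N)=0$ for all $j=1,\dots,d$, then there is an isomorphism of $R$-modules $M\otimes_R N^\dagger\cong \operatorname{Hom}_R(M,N)^\dagger$, and, if $M\neq 0$, the $R$-modules $M\otimes_R N^\dagger$ and $\operatorname{Hom}_R(M,N)$ are maximal Cohen–Macaulay. (ii) If $\operatorname{Ext}^j_R(M,N)=0$ for all $j=1,\dots,d+n$, then $$\operatorname{Ext}^d_R(\operatorname{Ext}^{d+n+1}_R(M,N),\omega)\cong \operatorname{Tor}^R_{n+1}(M,N^\dagger),$$ and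 $\operatorname{Tor}^R_i(M,N^\dagger)=0$ for all $i=1,\dots,n$. Moreover, there exists an exact sequence $$\operatorname{Tor}^R_{n+3}(M,N^\dagger)\to \operatorname{Ext}^{d-2}_R(\operatorname{Ext}^{d+n+1}_R(M,N),\omega)\to \operatorname{Ext}^{d}_R(\operatorname{Ext}^{d+n+2}_R(M,N),\omega)\to \operatorname{Tor}^R_{n+2}(M,N^\dagger)\to \operatorname{Ext}^{d-1}_R(\operatorname{Ext}^{d+n+1}_R(M,N),\omega)\to 0.$$ (iii) If $\operatorname{Tor}^R_j(M,N^\dagger)=0$ for all $j=1,\dots,d+n$, then $$\operatorname{Tor}^R_{d+n+1}(M,N^\dagger)^\dagger\cong \operatorname{Ext}^{d+n+1}_R(M,N),\qquad \operatorname{Ext}^i_R(M\otimes_R N^\dagger,\omega)\cong \operatorname{Ext}^i_R(M,N)\quad\text{for all } i=0,\dots,d,$$ and $\operatorname{Ext}^k_R(M,N)=0$ for all $k=d+1,\dots,d+n$. Moreover, there exists an exact sequence $$0\to \operatorname{Ext}^1_R(\operatorname{Tor}^R_{d+n+1}(M,N^\dagger),\omega)\to \operatorname{Ext}^{d+n+2}_R(M,N)\to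 \operatorname{Tor}^R_{d+n+2}(M,N^\dagger)^\dagger\to \operatorname{Ext}^2_R(\operatorname{Tor}^R_{d+n+1}(M,N^\dagger),\omega)\to \operatorname{Ext}^{d+n+3}_R(M,N).$$ -/

import Mathlib

open CategoryTheory
open scoped TensorProduct

universe u

noncomputable section

/-- The depth of a module over a local ring: the supremum of the lengths of the `M`-regular
sequences contained in the maximal ideal. -/
def moduleDepth (R : Type u) [CommRing R] [IsLocalRing R]
    (M : Type u) [AddCommGroup M] [Module R M] : ℕ∞ :=
  ⨆ rs : {rs : List R // (∀ r ∈ rs, r ∈ IsLocalRing.maximalIdeal R) ∧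
    RingTheory.Sequence.IsRegular M rs}, (rs.1.length : ℕ∞)

/-- Cohen-Macaulay modules over a (Noetherian) local ring: nonzero, finitely generated, and with
depth equal to the Krull dimension. -/
structure IsCohenMacaulayModule (R : Type u) [CommRing R] [IsLocalRing R]
    (M : Type u) [AddCommGroup M] [Module R M] : Prop where
  nontrivial : Nontrivial M
  finite : Module.Finite R M
  depth_eq : (moduleDepth R M : WithBot ℕ∞) = Module.supportDim R M

/-- Maximal Cohen-Macaulay modules: Cohen-Macaulay modules of dimension `dim R`. -/
structure IsMaximalCohenMacaulay (R : Type u) [CommRing R] [IsLocalRing R]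
    (M : Type u) [AddCommGroup M] [Module R M] : Prop extends IsCohenMacaulayModule R M where
  dim_eq : Module.supportDim R M = ringKrullDim R

/-- A Cohen-Macaulay local ring: a Noetherian local ring which is Cohen-Macaulay as a module over
itself. -/
structure IsCohenMacaulayLocalRing (R : Type u) [CommRing R] [IsLocalRing R] : Prop where
  noetherian : IsNoetherianRing R
  cohenMacaulay : IsCohenMacaulayModule R R

/-- The `R`-module `Ext^n_R(M, N)`. -/
abbrev ExtModule (R : Type u) [CommRing R] (M N : Type u) [AddCommGroup M] [Module R M]
    [AddCommGroup N] [Module R N] (n : ℕ) : Type u :=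
  Abelian.Ext.{u} (ModuleCat.of R M) (ModuleCat.of R N) n

/-- The `R`-module `Ext^i_R(M, N)` for an arbitrary integer `i`, zero for `i < 0`. -/
def extInt (R : Type u) [CommRing R] (M N : Type u) [AddCommGroup M] [Module R M]
    [AddCommGroup N] [Module R N] : ℤ → ModuleCat.{u} R
  | Int.ofNat n => ModuleCat.of R (ExtModule R M N n)
  | Int.negSucc _ => ModuleCat.of R PUnit.{u + 1}

/-- The `R`-module `Tor_n^R(M, N)`, the value at `M` of the `n`-th left derived functor
of `- ⊗ N`. -/
abbrev TorModule (R : Type u) [CommRing R] (M N : Type u) [AddCommGroup M] [Module R M]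
    [AddCommGroup N] [Module R N] (n : ℕ) : Type u :=
  ((Tor' (ModuleCat.{u} R) n).obj (ModuleCat.of R M)).obj (ModuleCat.of R N)

/-- Canonical modules of a Cohen-Macaulay local ring `R`: maximal Cohen-Macaulay modules of finite
injective dimension and of type one, that is, with `Ext^d_R(k, ω)` of dimension one over the
residue field `k`, where `d = depth ω = dim R`. -/
structure IsCanonicalModule (R : Type u) [CommRing R] [IsLocalRing R]
    (ω : Type u) [AddCommGroup ω] [Module R ω] : Prop
    extends IsMaximalCohenMacaulay R ω where
  finite_injectiveDimension : ∃ n : ℕ, HasInjectiveDimensionLE (ModuleCat.of R ω) n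
  type_one : ∃ d : ℕ, moduleDepth R ω = d ∧
    Nonempty (ExtModule R (IsLocalRing.ResidueField R) ω d ≃ₗ[R] IsLocalRing.ResidueField R)

/-- The dual `M^† = Hom_R(M, ω)` of `M` with respect to `ω`. -/
abbrev CanonicalDual (R : Type u) [CommRing R] (ω M : Type u) [AddCommGroup ω] [Module R ω]
    [AddCommGroup M] [Module R M] : Type u :=
  M →ₗ[R] ω

end

/-!
Let `F` be a resolution of `M` by finite free modules and let `N` be maximal Cohen-Macaulay. The
complexes `Hom(F, N)` and `F ⊗ N^†` are exchanged by `(-)^†`, since `Hom(F, N)^† ≅ F ⊗ N^†` for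
finite free `F` and `N^†† ≅ N`, and `Ext^p(-, ω)` vanishes on their terms for `p > 0`. The Ext
modules of `M` and `N`, respectively the Tor modules of `M` and `N^†`, are the homology modules of
these complexes. As `Ext^p(-, ω)` vanishes altogether for `p > d`, the usual spectral sequences
degenerate far enough that dimension shifting along the four-term exact sequences
`0 → ker → coker → term → coker → 0` cut from the complex replaces them.

The biduality `N^†† ≅ N` follows from `End ω ≅ R`: the first duality, applied to `(N, ω)` in place
of `(M, N)`, gives `N^†† ≅ N ⊗ End ω`. Applied to the residue field `k` and `ω`, it gives
`k ⊗ End ω ≅ Ext^d(Ext^d(k, ω), ω) ≅ k`, so `R → End ω` is surjective; applied to the kernel `I` of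
this map and `ω`, it gives `I ⊗ End ω ≅ Hom(I, ω)^† = 0`, so it is injective.
-/

noncomputable section

namespace ExtModule

variable {R : Type u} [CommRing R]
  {A B C Y : Type u} [AddCommGroup A] [Module R A] [AddCommGroup B] [Module R B]
  [AddCommGroup C] [Module R C] [AddCommGroup Y] [Module R Y]

/-- The map `Ext^n(B, Y) → Ext^n(A, Y)` induced by `f : A → B`. -/
def precomp (Y : Type u) [AddCommGroup Y] [Module R Y] (f : A →ₗ[R] B) (n : ℕ) :
    ExtModule R B Y n →ₗ[R] ExtModule R A Y n :=
  (Abelian.Ext.mk₀ (ModuleCat.ofHom f)).precompOfLinear R (ModuleCat.of R Y) (zero_add n)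

lemma precomp_comp (f : A →ₗ[R] B) (g : B →ₗ[R] C) (n : ℕ) (x : ExtModule R C Y n) :
    precomp Y (g ∘ₗ f) n x = precomp Y f n (precomp Y g n x) := by
  simp [precomp, ModuleCat.ofHom_comp]

lemma precomp_id (n : ℕ) (x : ExtModule R A Y n) :
    precomp Y (LinearMap.id : A →ₗ[R] A) n x = x := by
  simp [precomp]

lemma precomp_lsmul (r : R) (n : ℕ) (x : ExtModule R A Y n) :
    precomp Y (LinearMap.lsmul R A r) n x = r • x := by
  have : ModuleCat.ofHom (LinearMap.lsmul R A r) = r • 𝟙 (ModuleCat.of R A) := rfl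
  simp [precomp, this, Abelian.Ext.mk₀_smul]

lemma precomp_zero (n : ℕ) (x : ExtModule R B Y n) :
    precomp Y (0 : A →ₗ[R] B) n x = 0 := by
  have : ModuleCat.ofHom (0 : A →ₗ[R] B) = 0 := rfl
  simp [precomp, this]

/-- The isomorphism of `Ext^n(-, Y)` induced by a linear equivalence. -/
def congrLeft (e : A ≃ₗ[R] B) (n : ℕ) : ExtModule R A Y n ≃ₗ[R] ExtModule R B Y n :=
  LinearEquiv.ofLinearMap (precomp Y e.symm.toLinearMap n) (precomp Y e.toLinearMap n)
    (by ext x; simp [← precomp_comp, precomp_id]) (by ext x; simp [← precomp_comp, precomp_id])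

/-- The isomorphism of `Ext^n(A, -)` induced by a linear equivalence. -/
def congrRight (e : B ≃ₗ[R] C) (n : ℕ) : ExtModule R A B n ≃ₗ[R] ExtModule R A C n :=
  LinearEquiv.ofLinearMap
    ((Abelian.Ext.mk₀ e.toModuleIso.hom).postcompOfLinear R (ModuleCat.of R A) (add_zero n))
    ((Abelian.Ext.mk₀ e.toModuleIso.inv).postcompOfLinear R (ModuleCat.of R A) (add_zero n))
    (by ext x; simp [← ModuleCat.ofHom_comp]) (by ext x; simp [← ModuleCat.ofHom_comp])

/-- The identification of `Ext^0` with `Hom`. -/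
def zeroEquiv (A Y : Type u) [AddCommGroup A] [Module R A] [AddCommGroup Y] [Module R Y] :
    ExtModule R A Y 0 ≃ₗ[R] (A →ₗ[R] Y) :=
  Abelian.Ext.linearEquiv₀.trans ModuleCat.homLinearEquiv

lemma precomp_zeroEquiv_symm (f : A →ₗ[R] B) (φ : B →ₗ[R] Y) :
    precomp Y f 0 ((zeroEquiv B Y).symm φ) = (zeroEquiv A Y).symm (φ ∘ₗ f) := by
  have (D : Type u) [AddCommGroup D] [Module R D] (ψ : D →ₗ[R] Y) :
      (zeroEquiv D Y).symm ψ = Abelian.Ext.mk₀ (ModuleCat.ofHom ψ) := rfl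
  simp [precomp, this]

lemma precomp_zero_injective {f : A →ₗ[R] B} (hf : Function.Surjective f) :
    Function.Injective (precomp Y f 0) := by
  intro x y hxy
  obtain ⟨φ, rfl⟩ := (zeroEquiv B Y).symm.surjective x
  obtain ⟨ψ, rfl⟩ := (zeroEquiv B Y).symm.surjective y
  rw [precomp_zeroEquiv_symm, precomp_zeroEquiv_symm] at hxy
  rw [(LinearMap.cancel_right hf).mp ((zeroEquiv A Y).symm.injective hxy)]

instance subsingleton_of_subsingleton [Subsingleton A] (n : ℕ) :
    Subsingleton (ExtModule R A Y n) := by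
  refine subsingleton_of_forall_eq 0 fun x => ?_
  rw [← precomp_id n x, Subsingleton.elim (LinearMap.id : A →ₗ[R] A) 0, precomp_zero]

lemma subsingleton_of_projective [Module.Projective R A] {n : ℕ} (hn : 1 ≤ n) :
    Subsingleton (ExtModule R A Y n) := by
  obtain ⟨n, rfl⟩ := Nat.exists_eq_add_of_le' hn
  exact subsingleton_of_forall_eq 0 fun x => Abelian.Ext.eq_zero_of_projective x

section LongExactSequence

variable {f : A →ₗ[R] B} {g : B →ₗ[R] C} (hf : Function.Injective f)
  (hfg : Function.Exact f g) (hg : Function.Surjective g)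

include hf hfg hg in
lemma shortExact :
    (ModuleCat.shortComplexOfCompEqZero f g hfg.linearMap_comp_eq_zero).ShortExact :=
  ModuleCat.shortComplex_shortExact _ hfg hf hg

/-- The connecting map `Ext^n(A, Y) → Ext^{n+1}(C, Y)` of a short exact sequence
`0 → A → B → C → 0`. -/
def δ (Y : Type u) [AddCommGroup Y] [Module R Y] (n : ℕ) :
    ExtModule R A Y n →ₗ[R] ExtModule R C Y (n + 1) :=
  (shortExact hf hfg hg).extClass.precompOfLinear R (ModuleCat.of R Y) (add_comm 1 n)

include hf hfg hg

lemma exact_precomp_precomp (n : ℕ) : Function.Exact (precomp Y g n) (precomp Y f n) := by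
  have := Abelian.Ext.contravariant_sequence_exact₂' (shortExact hf hfg hg) (ModuleCat.of R Y) n
  rwa [ShortComplex.ab_exact_iff_function_exact] at this

lemma exact_precomp_δ (n : ℕ) : Function.Exact (precomp Y f n) (δ hf hfg hg Y n) := by
  have := Abelian.Ext.contravariant_sequence_exact₁' (shortExact hf hfg hg)
    (ModuleCat.of R Y) n (n + 1) (add_comm 1 n)
  rwa [ShortComplex.ab_exact_iff_function_exact] at this

lemma exact_δ_precomp (n : ℕ) : Function.Exact (δ hf hfg hg Y n) (precomp Y g (n + 1)) := by
  have := Abelian.Ext.contravariant_sequence_exact₃' (shortExact hf hfg hg)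
    (ModuleCat.of R Y) n (n + 1) (add_comm 1 n)
  rwa [ShortComplex.ab_exact_iff_function_exact] at this

lemma δ_injective (n : ℕ) [Subsingleton (ExtModule R B Y n)] :
    Function.Injective (δ hf hfg hg Y n) := by
  rw [injective_iff_map_eq_zero]
  intro x hx
  obtain ⟨y, rfl⟩ := (exact_precomp_δ hf hfg hg n x).mp hx
  rw [Subsingleton.elim y 0, map_zero]

lemma δ_surjective (n : ℕ) [Subsingleton (ExtModule R B Y (n + 1))] :
    Function.Surjective (δ hf hfg hg Y n) := fun x =>
  (exact_δ_precomp hf hfg hg n x).mp (Subsingleton.elim _ _)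

lemma precomp_surjective (n : ℕ) [Subsingleton (ExtModule R C Y (n + 1))] :
    Function.Surjective (precomp Y f n) := fun x =>
  (exact_precomp_δ hf hfg hg n x).mp (Subsingleton.elim _ _)

lemma subsingleton_middle (n : ℕ) [Subsingleton (ExtModule R A Y n)]
    [Subsingleton (ExtModule R C Y n)] : Subsingleton (ExtModule R B Y n) := by
  refine subsingleton_of_forall_eq 0 fun x => ?_
  obtain ⟨y, rfl⟩ := (exact_precomp_precomp (Y := Y) hf hfg hg n x).mp (Subsingleton.elim _ _)
  rw [Subsingleton.elim y 0, map_zero]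

lemma subsingleton_left (n : ℕ) [Subsingleton (ExtModule R B Y n)]
    [Subsingleton (ExtModule R C Y (n + 1))] : Subsingleton (ExtModule R A Y n) :=
  subsingleton_of_forall_eq 0 fun _ =>
    δ_injective (Y := Y) hf hfg hg n (Subsingleton.elim _ _)

lemma subsingleton_right (n : ℕ) [Subsingleton (ExtModule R A Y n)]
    [Subsingleton (ExtModule R B Y (n + 1))] : Subsingleton (ExtModule R C Y (n + 1)) :=
  (δ_surjective (Y := Y) hf hfg hg n).subsingleton

end LongExactSequence

/-- The cokernel of `Ext^p(P, Y) → Ext^p(C, Y)` for `u : C → P`. It is `Ext^p(C, Y)` when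
`Ext^p(P, Y) = 0`, and in degree zero it consists of the maps `C → Y` modulo those that
factor through `u`. -/
abbrev reducedExt {P : Type u} [AddCommGroup P] [Module R P] (Y : Type u) [AddCommGroup Y]
    [Module R Y] (u : C →ₗ[R] P) (p : ℕ) : Type u :=
  ExtModule R C Y p ⧸ LinearMap.range (precomp Y u p)

section ReducedExt

variable {P : Type u} [AddCommGroup P] [Module R P]

/-- The isomorphism between `reducedExt` and `Ext^p(C, Y)` when `Ext^p(P, Y) = 0`. -/
def reducedExtEquiv (u : C →ₗ[R] P) (p : ℕ) [Subsingleton (ExtModule R P Y p)] :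
    reducedExt Y u p ≃ₗ[R] ExtModule R C Y p :=
  Submodule.quotEquivOfEqBot _ (LinearMap.range_eq_bot.mpr (Subsingleton.elim _ _))

/-- The class of a linear map `C → Y` modulo the maps that factor through `u`. -/
def reducedExtMk (Y : Type u) [AddCommGroup Y] [Module R Y] (u : C →ₗ[R] P) :
    (C →ₗ[R] Y) →ₗ[R] reducedExt Y u 0 :=
  Submodule.mkQ _ ∘ₗ (zeroEquiv C Y).symm.toLinearMap

lemma reducedExtMk_surjective (u : C →ₗ[R] P) : Function.Surjective (reducedExtMk Y u) :=
  (Submodule.mkQ_surjective _).comp (zeroEquiv C Y).symm.surjective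

lemma reducedExtMk_eq_zero_iff (u : C →ₗ[R] P) (φ : C →ₗ[R] Y) :
    reducedExtMk Y u φ = 0 ↔ ∃ ψ : P →ₗ[R] Y, ψ ∘ₗ u = φ := by
  simp only [reducedExtMk, LinearMap.comp_apply, LinearEquiv.coe_coe, Submodule.mkQ_apply,
    Submodule.Quotient.mk_eq_zero, LinearMap.mem_range]
  rw [(zeroEquiv P Y).symm.surjective.exists]
  simp [precomp_zeroEquiv_symm]

end ReducedExt

end ExtModule

open ExtModule

variable {R : Type u} [CommRing R]

/-- An exact sequence `C → P → C' → 0` in which `P` is acyclic for `Hom(-, Y)`. The long exact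
sequences of `0 → ker u → C → range u → 0` and `0 → range u → P → C' → 0` splice together
into the one relating `Ext(ker u, Y)`, `Ext(C, Y)` and `Ext(C', Y)`. -/
structure AcyclicPresentation (R : Type u) [CommRing R] (Y C P C' : Type u)
    [AddCommGroup Y] [Module R Y] [AddCommGroup C] [Module R C] [AddCommGroup P] [Module R P]
    [AddCommGroup C'] [Module R C'] where
  u : C →ₗ[R] P
  π : P →ₗ[R] C'
  exact : Function.Exact u π
  π_surjective : Function.Surjective π
  acyclic (p : ℕ) : Subsingleton (ExtModule R P Y (p + 1))

namespace AcyclicPresentation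

variable {Y C P C' : Type u} [AddCommGroup Y] [Module R Y] [AddCommGroup C] [Module R C]
  [AddCommGroup P] [Module R P] [AddCommGroup C'] [Module R C']
  (S : AcyclicPresentation R Y C P C')

lemma exact_ker_subtype_rangeRestrict :
    Function.Exact (LinearMap.ker S.u).subtype S.u.rangeRestrict :=
  LinearMap.exact_iff.mpr (by rw [LinearMap.ker_rangeRestrict, Submodule.range_subtype])

lemma exact_range_subtype : Function.Exact (LinearMap.range S.u).subtype S.π :=
  LinearMap.exact_iff.mpr (by rw [Submodule.range_subtype, S.exact.linearMap_ker_eq])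

/-- The connecting map of `0 → ker u → C → range u → 0`. -/
abbrev δKer (p : ℕ) :
    ExtModule R (LinearMap.ker S.u) Y p →ₗ[R] ExtModule R (LinearMap.range S.u) Y (p + 1) :=
  δ (Submodule.subtype_injective _) S.exact_ker_subtype_rangeRestrict
    S.u.surjective_rangeRestrict Y p

/-- The connecting map of `0 → range u → P → C' → 0`. -/
abbrev δRange (p : ℕ) :
    ExtModule R (LinearMap.range S.u) Y p →ₗ[R] ExtModule R C' Y (p + 1) :=
  δ (Submodule.subtype_injective _) S.exact_range_subtype S.π_surjective Y p

lemma δRange_surjective (p : ℕ) : Function.Surjective (S.δRange p) :=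
  have := S.acyclic p
  δ_surjective _ _ _ p

lemma δRange_injective (p : ℕ) : Function.Injective (S.δRange (p + 1)) :=
  have := S.acyclic p
  δ_injective _ _ _ (p + 1)

lemma δRange_eq_zero_iff (p : ℕ) (x : ExtModule R (LinearMap.range S.u) Y p) :
    S.δRange p x = 0 ↔ ∃ z, precomp Y (LinearMap.range S.u).subtype p z = x :=
  exact_precomp_δ _ _ _ p x

lemma precomp_u (p : ℕ) (z : ExtModule R P Y p) :
    precomp Y S.u p z =
      precomp Y S.u.rangeRestrict p (precomp Y (LinearMap.range S.u).subtype p z) :=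
  precomp_comp S.u.rangeRestrict (LinearMap.range S.u).subtype p z

/-- The map `Ext^{p+1}(C', Y) → reducedExt Y u p`, characterised by `fromExt_δRange`. -/
def fromExt (p : ℕ) : ExtModule R C' Y (p + 1) →ₗ[R] reducedExt Y S.u p :=
  (LinearMap.ker (S.δRange p)).liftQ
      ((LinearMap.range (precomp Y S.u p)).mkQ ∘ₗ precomp Y S.u.rangeRestrict p) (by
        intro x hx
        obtain ⟨z, rfl⟩ := (S.δRange_eq_zero_iff p x).mp hx
        simp [← S.precomp_u]) ∘ₗ
    ((S.δRange p).quotKerEquivOfSurjective (S.δRange_surjective p)).symm.toLinearMap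

lemma fromExt_δRange (p : ℕ) (x : ExtModule R (LinearMap.range S.u) Y p) :
    S.fromExt p (S.δRange p x) = Submodule.Quotient.mk (precomp Y S.u.rangeRestrict p x) := by
  have : ((S.δRange p).quotKerEquivOfSurjective (S.δRange_surjective p)).symm (S.δRange p x) =
      Submodule.Quotient.mk x := by
    rw [LinearEquiv.symm_apply_eq]; rfl
  simp [fromExt, this]

lemma fromExt_δRange_eq_zero_iff (p : ℕ) (x : ExtModule R (LinearMap.range S.u) Y p) :
    S.fromExt p (S.δRange p x) = 0 ↔
      ∃ z, precomp Y S.u.rangeRestrict p (precomp Y (LinearMap.range S.u).subtype p z) =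
        precomp Y S.u.rangeRestrict p x := by
  rw [fromExt_δRange, Submodule.Quotient.mk_eq_zero, LinearMap.mem_range]
  simp only [precomp_u]

/-- The map `reducedExt Y u p → Ext^p(ker u, Y)` induced by restriction to `ker u`. -/
def toExtKer (p : ℕ) : reducedExt Y S.u p →ₗ[R] ExtModule R (LinearMap.ker S.u) Y p :=
  (LinearMap.range (precomp Y S.u p)).liftQ (precomp Y (LinearMap.ker S.u).subtype p) (by
    rintro _ ⟨z, rfl⟩
    rw [LinearMap.mem_ker, ← precomp_comp, LinearMap.comp_ker_subtype, precomp_zero])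

lemma toExtKer_mk (p : ℕ) (x : ExtModule R C Y p) :
    S.toExtKer p (Submodule.Quotient.mk x) = precomp Y (LinearMap.ker S.u).subtype p x :=
  rfl

/-- The connecting map `Ext^p(ker u, Y) → Ext^{p+2}(C', Y)`. -/
def connecting (p : ℕ) : ExtModule R (LinearMap.ker S.u) Y p →ₗ[R] ExtModule R C' Y (p + 2) :=
  S.δRange (p + 1) ∘ₗ S.δKer p

lemma fromExt_zero_injective : Function.Injective (S.fromExt 0) := by
  rw [injective_iff_map_eq_zero]
  intro x hx
  obtain ⟨y, rfl⟩ := S.δRange_surjective 0 x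
  obtain ⟨z, hz⟩ := (S.fromExt_δRange_eq_zero_iff 0 y).mp hx
  exact (S.δRange_eq_zero_iff 0 y).mpr
    ⟨z, precomp_zero_injective S.u.surjective_rangeRestrict hz⟩

lemma exact_fromExt_toExtKer (p : ℕ) : Function.Exact (S.fromExt p) (S.toExtKer p) := by
  intro x
  obtain ⟨x, rfl⟩ := Submodule.Quotient.mk_surjective _ x
  rw [toExtKer_mk, exact_precomp_precomp (Submodule.subtype_injective _)
    S.exact_ker_subtype_rangeRestrict S.u.surjective_rangeRestrict p x]
  constructor
  · rintro ⟨y, rfl⟩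
    exact ⟨S.δRange p y, S.fromExt_δRange p y⟩
  · rintro ⟨y, hy⟩
    obtain ⟨y, rfl⟩ := S.δRange_surjective p y
    rw [fromExt_δRange, eq_comm, Submodule.Quotient.eq] at hy
    obtain ⟨z, hz⟩ := hy
    refine ⟨precomp Y (LinearMap.range S.u).subtype p z + y, ?_⟩
    rw [map_add, ← S.precomp_u, hz, sub_add_cancel]

lemma exact_toExtKer_connecting (p : ℕ) : Function.Exact (S.toExtKer p) (S.connecting p) := by
  intro x
  rw [connecting, LinearMap.comp_apply, map_eq_zero_iff _ (S.δRange_injective p),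
    exact_precomp_δ (Submodule.subtype_injective _) S.exact_ker_subtype_rangeRestrict
      S.u.surjective_rangeRestrict p x]
  exact ((Submodule.mkQ_surjective (LinearMap.range (precomp Y S.u p))).exists
    (p := fun y => S.toExtKer p y = x)).symm

lemma exact_connecting_fromExt (p : ℕ) : Function.Exact (S.connecting p) (S.fromExt (p + 1)) := by
  intro x
  obtain ⟨y, rfl⟩ := S.δRange_surjective (p + 1) x
  have fromExt_eq_zero_iff : S.fromExt (p + 1) (S.δRange (p + 1) y) = 0 ↔
      precomp Y S.u.rangeRestrict (p + 1) y = 0 := by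
    have := S.acyclic p
    rw [fromExt_δRange_eq_zero_iff]
    refine ⟨fun ⟨z, hz⟩ => ?_, fun h => ⟨0, by rw [map_zero, map_zero, h]⟩⟩
    rw [← hz, Subsingleton.elim z 0, map_zero, map_zero]
  rw [fromExt_eq_zero_iff, exact_δ_precomp (Submodule.subtype_injective _)
    S.exact_ker_subtype_rangeRestrict S.u.surjective_rangeRestrict p y]
  simp only [connecting, LinearMap.coe_comp, Set.mem_range, Function.comp_apply,
    (S.δRange_injective p).eq_iff]

lemma nonempty_ext_equiv_reducedExt [Subsingleton (LinearMap.ker S.u)] (p : ℕ) :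
    Nonempty (ExtModule R C' Y (p + 1) ≃ₗ[R] reducedExt Y S.u p) := by
  refine ⟨LinearEquiv.ofBijective (S.fromExt p) ⟨?_, fun x =>
    (S.exact_fromExt_toExtKer p x).mp (Subsingleton.elim _ _)⟩⟩
  rcases p with _ | p
  · exact S.fromExt_zero_injective
  · rw [injective_iff_map_eq_zero]
    intro x hx
    obtain ⟨y, rfl⟩ := (S.exact_connecting_fromExt p x).mp hx
    rw [Subsingleton.elim y 0, map_zero]

lemma nonempty_reducedExt_equiv_ext_ker (p : ℕ) [Subsingleton (ExtModule R C' Y (p + 1))]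
    [Subsingleton (ExtModule R C' Y (p + 2))] :
    Nonempty (reducedExt Y S.u p ≃ₗ[R] ExtModule R (LinearMap.ker S.u) Y p) := by
  refine ⟨LinearEquiv.ofBijective (S.toExtKer p) ⟨?_, fun x =>
    (S.exact_toExtKer_connecting p x).mp (Subsingleton.elim _ _)⟩⟩
  rw [injective_iff_map_eq_zero]
  intro x hx
  obtain ⟨y, rfl⟩ := (S.exact_fromExt_toExtKer p x).mp hx
  rw [Subsingleton.elim y 0, map_zero]

/-- The identification of `reducedExt Y S.u` with `Ext(C, Y)` in positive degrees. -/
def reducedExtEquiv (p : ℕ) : reducedExt Y S.u (p + 1) ≃ₗ[R] ExtModule R C Y (p + 1) :=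
  have := S.acyclic p
  ExtModule.reducedExtEquiv S.u (p + 1)

end AcyclicPresentation

section ExactSequences

variable (R : Type*) [CommRing R] (A₁ A₂ A₃ A₄ A₅ : Type*)
  [AddCommGroup A₁] [Module R A₁] [AddCommGroup A₂] [Module R A₂] [AddCommGroup A₃] [Module R A₃]
  [AddCommGroup A₄] [Module R A₄] [AddCommGroup A₅] [Module R A₅]

/-- The existence of an exact sequence `A₁ → A₂ → A₃ → A₄ → A₅ → 0`. -/
def ExistsExactSeqToZero : Prop :=
  ∃ (f₁ : A₁ →ₗ[R] A₂) (f₂ : A₂ →ₗ[R] A₃) (f₃ : A₃ →ₗ[R] A₄) (f₄ : A₄ →ₗ[R] A₅),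
    Function.Exact f₁ f₂ ∧ Function.Exact f₂ f₃ ∧ Function.Exact f₃ f₄ ∧ Function.Surjective f₄

/-- The existence of an exact sequence `0 → A₁ → A₂ → A₃ → A₄ → A₅`. -/
def ExistsExactSeqFromZero : Prop :=
  ∃ (g₁ : A₁ →ₗ[R] A₂) (g₂ : A₂ →ₗ[R] A₃) (g₃ : A₃ →ₗ[R] A₄) (g₄ : A₄ →ₗ[R] A₅),
    Function.Injective g₁ ∧ Function.Exact g₁ g₂ ∧ Function.Exact g₂ g₃ ∧ Function.Exact g₃ g₄

variable {R A₁ A₂ A₃ A₄ A₅} {B₁ B₂ B₃ B₄ B₅ : Type*}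
  [AddCommGroup B₁] [Module R B₁] [AddCommGroup B₂] [Module R B₂] [AddCommGroup B₃] [Module R B₃]
  [AddCommGroup B₄] [Module R B₄] [AddCommGroup B₅] [Module R B₅]

lemma exact_arrowCongr (e₁ : A₁ ≃ₗ[R] B₁) (e₂ : A₂ ≃ₗ[R] B₂) (e₃ : A₃ ≃ₗ[R] B₃)
    {f : A₁ →ₗ[R] A₂} {g : A₂ →ₗ[R] A₃} (h : Function.Exact f g) :
    Function.Exact (e₁.arrowCongr e₂ f) (e₂.arrowCongr e₃ g) :=
  h.of_ladder_linearEquiv_of_exact (e₁ := e₁) (e₂ := e₂) (e₃ := e₃) (by ext; simp) (by ext; simp)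

lemma ExistsExactSeqToZero.congr (h : ExistsExactSeqToZero R A₁ A₂ A₃ A₄ A₅) (e₁ : A₁ ≃ₗ[R] B₁)
    (e₂ : A₂ ≃ₗ[R] B₂) (e₃ : A₃ ≃ₗ[R] B₃) (e₄ : A₄ ≃ₗ[R] B₄) (e₅ : A₅ ≃ₗ[R] B₅) :
    ExistsExactSeqToZero R B₁ B₂ B₃ B₄ B₅ := by
  obtain ⟨f₁, f₂, f₃, f₄, h₁, h₂, h₃, h₄⟩ := h
  exact ⟨_, _, _, _, exact_arrowCongr e₁ e₂ e₃ h₁, exact_arrowCongr e₂ e₃ e₄ h₂,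
    exact_arrowCongr e₃ e₄ e₅ h₃, e₅.surjective.comp (h₄.comp e₄.symm.surjective)⟩

lemma ExistsExactSeqFromZero.congr (h : ExistsExactSeqFromZero R A₁ A₂ A₃ A₄ A₅)
    (e₁ : A₁ ≃ₗ[R] B₁) (e₂ : A₂ ≃ₗ[R] B₂) (e₃ : A₃ ≃ₗ[R] B₃) (e₄ : A₄ ≃ₗ[R] B₄)
    (e₅ : A₅ ≃ₗ[R] B₅) : ExistsExactSeqFromZero R B₁ B₂ B₃ B₄ B₅ := by
  obtain ⟨g₁, g₂, g₃, g₄, h₁, h₂, h₃, h₄⟩ := h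
  exact ⟨_, _, _, _, e₂.injective.comp (h₁.comp e₁.symm.injective), exact_arrowCongr e₁ e₂ e₃ h₂,
    exact_arrowCongr e₂ e₃ e₄ h₃, exact_arrowCongr e₃ e₄ e₅ h₄⟩

lemma ExistsExactSeqToZero.of_injective [Subsingleton A₂] {f : A₃ →ₗ[R] A₄} {g : A₄ →ₗ[R] A₅}
    (hf : Function.Injective f) (hfg : Function.Exact f g) (hg : Function.Surjective g) :
    ExistsExactSeqToZero R A₁ A₂ A₃ A₄ A₅ :=
  ⟨0, 0, f, g, (LinearMap.exact_zero_iff_surjective _ _).mpr fun _ => ⟨0, Subsingleton.elim _ _⟩,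
    (LinearMap.exact_zero_iff_injective _ _).mpr hf, hfg, hg⟩

lemma ExistsExactSeqToZero.of_linearEquiv [Subsingleton A₂] [Subsingleton A₅] (e : A₃ ≃ₗ[R] A₄) :
    ExistsExactSeqToZero R A₁ A₂ A₃ A₄ A₅ :=
  .of_injective e.injective ((LinearMap.exact_zero_iff_surjective _ _).mpr e.surjective)
    fun _ => ⟨0, Subsingleton.elim _ _⟩

end ExactSequences

section ExtInt

variable {X Y : Type u} [AddCommGroup X] [Module R X] [AddCommGroup Y] [Module R Y]

/-- The isomorphism of `extInt` in the first variable induced by a linear equivalence. -/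
def extIntCongrLeft {X' : Type u} [AddCommGroup X'] [Module R X'] (e : X ≃ₗ[R] X') :
    ∀ z : ℤ, extInt R X Y z ≃ₗ[R] extInt R X' Y z
  | Int.ofNat p => congrLeft e p
  | Int.negSucc _ => LinearEquiv.refl R _

lemma subsingleton_extInt_of_neg {z : ℤ} (hz : z < 0) : Subsingleton (extInt R X Y z) := by
  match z with
  | Int.negSucc _ => exact inferInstanceAs (Subsingleton PUnit)

lemma nonempty_ext_equiv_extInt {z : ℤ} {p : ℕ} (hz : z = p) :
    Nonempty (ExtModule R X Y p ≃ₗ[R] extInt R X Y z) := by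
  subst hz; exact ⟨LinearEquiv.refl R _⟩

end ExtInt

variable {Y : Type u} [AddCommGroup Y] [Module R Y]

/-- Vanishing of `Ext^p(X, Y)` in all degrees `p > d` for all finitely generated `X`; over a
Noetherian ring this says that the injective dimension of `Y` is at most `d`. -/
def ExtVanishesAbove (R : Type u) [CommRing R] (Y : Type u) [AddCommGroup Y] [Module R Y]
    (d : ℕ) : Prop :=
  ∀ (X : Type u) [AddCommGroup X] [Module R X] [Module.Finite R X] (p : ℕ), d < p →
    Subsingleton (ExtModule R X Y p)

namespace AcyclicPresentation

section Ascending

variable {C P : ℕ → Type u} [∀ q, AddCommGroup (C q)] [∀ q, Module R (C q)]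
  [∀ q, AddCommGroup (P q)] [∀ q, Module R (P q)]
  (S : ∀ q, AcyclicPresentation R Y (C q) (P q) (C (q + 1)))

lemma nonempty_reducedExt_equiv_shift (k : ℕ) {q e p r : ℕ} (he : e = q + k) (hr : r = p + k)
    (hH : ∀ j, q ≤ j → j < e → Subsingleton (LinearMap.ker (S j).u)) :
    Nonempty (reducedExt Y (S q).u p ≃ₗ[R] reducedExt Y (S e).u r) := by
  induction k generalizing e r with
  | zero => subst he hr; exact ⟨LinearEquiv.refl R _⟩
  | succ k ih =>
    subst he hr
    obtain ⟨shift⟩ := ih rfl rfl fun j h₁ h₂ => hH j h₁ (by lia)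
    have := hH (q + k) (by lia) (by lia)
    obtain ⟨succ⟩ := (S (q + k)).nonempty_ext_equiv_reducedExt (p + k)
    exact ⟨shift.trans (succ.symm.trans ((S (q + k + 1)).reducedExtEquiv (p + k)).symm)⟩

variable [∀ q, Module.Finite R (C q)] {d : ℕ} (hY : ExtVanishesAbove R Y d)

include hY

lemma nonempty_reducedExt_top_equiv_ext_ker (e : ℕ) :
    Nonempty (reducedExt Y (S e).u d ≃ₗ[R] ExtModule R (LinearMap.ker (S e).u) Y d) :=
  have := hY (C (e + 1)) (d + 1) (by lia)
  have := hY (C (e + 1)) (d + 2) (by lia)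
  (S e).nonempty_reducedExt_equiv_ext_ker d

lemma nonempty_reducedExt_zero_equiv_ext_ker {q e : ℕ} (he : e = q + d)
    (hH : ∀ j, q ≤ j → j < e → Subsingleton (LinearMap.ker (S j).u)) :
    Nonempty (reducedExt Y (S q).u 0 ≃ₗ[R] ExtModule R (LinearMap.ker (S e).u) Y d) := by
  obtain ⟨shift⟩ := nonempty_reducedExt_equiv_shift S d he (zero_add d).symm hH
  obtain ⟨top⟩ := nonempty_reducedExt_top_equiv_ext_ker S hY e
  exact ⟨shift.trans top⟩

lemma subsingleton_ext_of_subsingleton_ker {q : ℕ}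
    (hH : ∀ j, q ≤ j → j < q + d → Subsingleton (LinearMap.ker (S j).u)) {p : ℕ} (hp : 1 ≤ p) :
    Subsingleton (ExtModule R (C q) Y p) := by
  obtain ⟨p, rfl⟩ := Nat.exists_eq_add_of_le' hp
  obtain ⟨shift⟩ := nonempty_reducedExt_equiv_shift S (p := p + 1) (r := p + d + 1) d rfl
    (by lia) hH
  have := hY (C (q + d)) (p + d + 1) (by lia)
  exact (((S q).reducedExtEquiv p).symm.trans
    (shift.trans ((S (q + d)).reducedExtEquiv (p + d)))).toEquiv.subsingleton

lemma nonempty_reducedExt_zero_equiv_dual_ker {q : ℕ}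
    (hH : ∀ j, q < j → j ≤ q + d → Subsingleton (LinearMap.ker (S j).u)) :
    Nonempty (reducedExt Y (S q).u 0 ≃ₗ[R] (LinearMap.ker (S q).u →ₗ[R] Y)) := by
  have acyclic {p : ℕ} (hp : 1 ≤ p) : Subsingleton (ExtModule R (C (q + 1)) Y p) :=
    subsingleton_ext_of_subsingleton_ker S hY (fun j h₁ h₂ => hH j h₁ (by lia)) hp
  have := acyclic le_rfl
  have := acyclic one_le_two
  obtain ⟨restrict⟩ := (S q).nonempty_reducedExt_equiv_ext_ker 0
  exact ⟨restrict.trans (zeroEquiv _ _)⟩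

omit hY in
lemma existsExactSeqToZero_of_dim_zero (hY : ExtVanishesAbove R Y 0) (e : ℕ) :
    ExistsExactSeqToZero R (reducedExt Y (S (e + 2)).u 0)
      (extInt R (LinearMap.ker (S e).u) Y (-2)) (ExtModule R (LinearMap.ker (S (e + 1)).u) Y 0)
      (reducedExt Y (S (e + 1)).u 0) (extInt R (LinearMap.ker (S e).u) Y (-1)) := by
  have : Subsingleton (extInt R (LinearMap.ker (S e).u) Y (-2)) :=
    subsingleton_extInt_of_neg (by lia)
  have : Subsingleton (extInt R (LinearMap.ker (S e).u) Y (-1)) :=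
    subsingleton_extInt_of_neg (by lia)
  obtain ⟨top⟩ := nonempty_reducedExt_top_equiv_ext_ker S hY (e + 1)
  exact .of_linearEquiv top.symm

omit hY in
lemma existsExactSeqToZero_of_dim_one (hY : ExtVanishesAbove R Y 1) (e : ℕ) :
    ExistsExactSeqToZero R (reducedExt Y (S (e + 1)).u 0)
      (extInt R (LinearMap.ker (S e).u) Y (-1)) (ExtModule R (LinearMap.ker (S (e + 1)).u) Y 1)
      (reducedExt Y (S e).u 0) (extInt R (LinearMap.ker (S e).u) Y 0) := by
  have : Subsingleton (extInt R (LinearMap.ker (S e).u) Y (-1)) :=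
    subsingleton_extInt_of_neg (by lia)
  have := hY (C (e + 1)) 2 (by lia)
  have : Function.Surjective ((S e).toExtKer 0) := fun x =>
    ((S e).exact_toExtKer_connecting 0 x).mp (Subsingleton.elim _ _)
  obtain ⟨top⟩ := nonempty_reducedExt_top_equiv_ext_ker S hY (e + 1)
  exact (ExistsExactSeqToZero.of_injective (S e).fromExt_zero_injective
    ((S e).exact_fromExt_toExtKer 0) this).congr (.refl R _) (.refl R _)
    (((S (e + 1)).reducedExtEquiv 0).symm.trans top) (.refl R _) (.refl R _)

omit hY in
lemma existsExactSeqToZero_of_two_le_dim (hY : ExtVanishesAbove R Y (d + 2)) {q e : ℕ}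
    (he : e = q + (d + 2))
    (hH : ∀ j, q ≤ j → j < e → Subsingleton (LinearMap.ker (S j).u)) :
    ExistsExactSeqToZero R (reducedExt Y (S (q + 2)).u 0)
      (ExtModule R (LinearMap.ker (S e).u) Y d)
      (ExtModule R (LinearMap.ker (S (e + 1)).u) Y (d + 2))
      (reducedExt Y (S (q + 1)).u 0) (ExtModule R (LinearMap.ker (S e).u) Y (d + 1)) := by
  have := hY (C (e + 1)) (d + 3) (by lia)
  have : Function.Surjective ((S e).toExtKer (d + 1)) := fun x =>
    ((S e).exact_toExtKer_connecting (d + 1) x).mp (Subsingleton.elim _ _)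
  have sequence : ExistsExactSeqToZero R (reducedExt Y (S e).u d)
      (ExtModule R (LinearMap.ker (S e).u) Y d) (ExtModule R (C (e + 1)) Y (d + 2))
      (reducedExt Y (S e).u (d + 1)) (ExtModule R (LinearMap.ker (S e).u) Y (d + 1)) :=
    ⟨_, _, _, _, (S e).exact_toExtKer_connecting d, (S e).exact_connecting_fromExt d,
      (S e).exact_fromExt_toExtKer (d + 1), this⟩
  obtain ⟨shift₂⟩ := nonempty_reducedExt_equiv_shift S d (q := q + 2) (e := e) (by lia)
    (zero_add d).symm fun j h₁ h₂ => hH j (by lia) h₂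
  obtain ⟨shift₁⟩ := nonempty_reducedExt_equiv_shift S (d + 1) (q := q + 1) (e := e) (by lia)
    (zero_add (d + 1)).symm fun j h₁ h₂ => hH j (by lia) h₂
  obtain ⟨top⟩ := nonempty_reducedExt_top_equiv_ext_ker S hY (e + 1)
  exact sequence.congr shift₂.symm (.refl R _)
    (((S (e + 1)).reducedExtEquiv (d + 1)).symm.trans top) shift₁.symm (.refl R _)

lemma existsExactSeqToZero {q e : ℕ} (he : e = q + d)
    (hH : ∀ j, q ≤ j → j < e → Subsingleton (LinearMap.ker (S j).u)) :
    ExistsExactSeqToZero R (reducedExt Y (S (q + 2)).u 0)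
      (extInt R (LinearMap.ker (S e).u) Y ((d : ℤ) - 2))
      (ExtModule R (LinearMap.ker (S (e + 1)).u) Y d) (reducedExt Y (S (q + 1)).u 0)
      (extInt R (LinearMap.ker (S e).u) Y ((d : ℤ) - 1)) := by
  match d with
  | 0 => subst he; exact existsExactSeqToZero_of_dim_zero S hY e
  | 1 => subst he; exact existsExactSeqToZero_of_dim_one S hY (q + 1)
  | d + 2 =>
    obtain ⟨ext₂⟩ := nonempty_ext_equiv_extInt (R := R) (X := LinearMap.ker (S e).u) (Y := Y)
      (z := ((d + 2 : ℕ) : ℤ) - 2) (p := d) (by lia)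
    obtain ⟨ext₁⟩ := nonempty_ext_equiv_extInt (R := R) (X := LinearMap.ker (S e).u) (Y := Y)
      (z := ((d + 2 : ℕ) : ℤ) - 1) (p := d + 1) (by lia)
    exact (existsExactSeqToZero_of_two_le_dim S hY he hH).congr (.refl R _) ext₂ (.refl R _)
      (.refl R _) ext₁

end Ascending

section Descending

variable {C P : ℕ → Type u} [∀ q, AddCommGroup (C q)] [∀ q, Module R (C q)]
  [∀ q, AddCommGroup (P q)] [∀ q, Module R (P q)]
  (S : ∀ q, AcyclicPresentation R Y (C (q + 1)) (P q) (C q))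

lemma nonempty_ext_equiv_ext_zero (i : ℕ) {p r : ℕ} (hr : r = p + i)
    (hT : ∀ j < i, Subsingleton (LinearMap.ker (S j).u)) :
    Nonempty (ExtModule R (C i) Y (p + 1) ≃ₗ[R] ExtModule R (C 0) Y (r + 1)) := by
  induction i generalizing p with
  | zero => subst hr; exact ⟨LinearEquiv.refl R _⟩
  | succ i ih =>
    have := hT i (by lia)
    obtain ⟨succ⟩ := (S i).nonempty_ext_equiv_reducedExt (p + 1)
    obtain ⟨shift⟩ := ih (p := p + 1) (by lia) fun j hj => hT j (by lia)
    exact ⟨((S i).reducedExtEquiv p).symm.trans (succ.symm.trans shift)⟩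

lemma nonempty_ext_zero_equiv_reducedExt_zero (i : ℕ)
    (hT : ∀ j ≤ i, Subsingleton (LinearMap.ker (S j).u)) :
    Nonempty (ExtModule R (C 0) Y (i + 1) ≃ₗ[R] reducedExt Y (S i).u 0) := by
  have := hT i le_rfl
  obtain ⟨succ⟩ := (S i).nonempty_ext_equiv_reducedExt 0
  obtain ⟨shift⟩ := nonempty_ext_equiv_ext_zero S i (zero_add i).symm fun j hj => hT j hj.le
  exact ⟨shift.symm.trans succ⟩

variable [Module.Finite R (C 0)] {d e : ℕ} (hY : ExtVanishesAbove R Y d)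
  (hT : ∀ j < e, Subsingleton (LinearMap.ker (S j).u)) (hde : d ≤ e)

include hY hT hde

lemma nonempty_reducedExt_equiv_ext_ker_of_dim_le (p : ℕ) :
    Nonempty (reducedExt Y (S e).u p ≃ₗ[R] ExtModule R (LinearMap.ker (S e).u) Y p) := by
  have acyclic (r : ℕ) : Subsingleton (ExtModule R (C e) Y (r + 1)) := by
    obtain ⟨shift⟩ := nonempty_ext_equiv_ext_zero S e (p := r) rfl hT
    have := hY (C 0) (r + e + 1) (by lia)
    exact shift.toEquiv.subsingleton
  have := acyclic p
  have := acyclic (p + 1)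
  exact (S e).nonempty_reducedExt_equiv_ext_ker p

lemma existsExactSeqFromZero :
    ExistsExactSeqFromZero R (ExtModule R (LinearMap.ker (S e).u) Y 1)
      (reducedExt Y (S (e + 1)).u 0) (LinearMap.ker (S (e + 1)).u →ₗ[R] Y)
      (ExtModule R (LinearMap.ker (S e).u) Y 2) (reducedExt Y (S (e + 2)).u 0) := by
  let inclusion := (S (e + 2)).fromExt 0 ∘ₗ ((S (e + 1)).reducedExtEquiv 0).toLinearMap
  have inclusion_injective : Function.Injective inclusion :=
    (S (e + 2)).fromExt_zero_injective.comp ((S (e + 1)).reducedExtEquiv 0).injective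
  have sequence : ExistsExactSeqFromZero R (ExtModule R (C (e + 1)) Y 1)
      (reducedExt Y (S (e + 1)).u 0) (ExtModule R (LinearMap.ker (S (e + 1)).u) Y 0)
      (ExtModule R (C (e + 1)) Y 2) (reducedExt Y (S (e + 2)).u 0) :=
    ⟨_, _, _, inclusion ∘ₗ (S (e + 1)).fromExt 1, (S (e + 1)).fromExt_zero_injective,
      (S (e + 1)).exact_fromExt_toExtKer 0, (S (e + 1)).exact_toExtKer_connecting 0,
      ((S (e + 1)).exact_connecting_fromExt 0).comp_injective inclusion inclusion_injective
        (map_zero _)⟩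
  obtain ⟨restrict₁⟩ := nonempty_reducedExt_equiv_ext_ker_of_dim_le S hY hT hde 1
  obtain ⟨restrict₂⟩ := nonempty_reducedExt_equiv_ext_ker_of_dim_le S hY hT hde 2
  exact sequence.congr (((S e).reducedExtEquiv 0).symm.trans restrict₁) (.refl R _)
    (zeroEquiv _ _) (((S e).reducedExtEquiv 1).symm.trans restrict₂) (.refl R _)

end Descending

end AcyclicPresentation

section Homology

variable {R : Type*} [CommRing R] {K₂ K₁ K₀ Q A B : Type*} [AddCommGroup K₂] [Module R K₂]
  [AddCommGroup K₁] [Module R K₁] [AddCommGroup K₀] [Module R K₀] [AddCommGroup Q] [Module R Q]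
  [AddCommGroup A] [Module R A] [AddCommGroup B] [Module R B]

lemma nonempty_linearEquiv_of_surjective {s : Q →ₗ[R] A} {t : Q →ₗ[R] B}
    (hs : Function.Surjective s) (ht : Function.Surjective t) (h : ∀ x, s x = 0 ↔ t x = 0) :
    Nonempty (A ≃ₗ[R] B) :=
  ⟨(s.quotKerEquivOfSurjective hs).symm.trans ((Submodule.quotEquivOfEq _ _
    (by ext x; exact h x)).trans (t.quotKerEquivOfSurjective ht))⟩

/-- The map `K₁ / im α → K₀` induced by `β` in a complex `K₂ → K₁ → K₀`. Its kernel is our model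
of the homology of the complex at `K₁`. -/
def cokernelMap (α : K₂ →ₗ[R] K₁) (β : K₁ →ₗ[R] K₀) (h : β ∘ₗ α = 0) :
    (K₁ ⧸ LinearMap.range α) →ₗ[R] K₀ :=
  (LinearMap.range α).liftQ β (LinearMap.range_le_ker_iff.mpr h)

lemma exact_cokernelMap_mkQ {α : K₂ →ₗ[R] K₁} {β : K₁ →ₗ[R] K₀} (h : β ∘ₗ α = 0) :
    Function.Exact (cokernelMap α β h) (LinearMap.range β).mkQ :=
  LinearMap.exact_iff.mpr (by rw [Submodule.ker_mkQ, cokernelMap, Submodule.range_liftQ])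

lemma subsingleton_ker_cokernelMap {α : K₂ →ₗ[R] K₁} {β : K₁ →ₗ[R] K₀}
    (h : Function.Exact α β) :
    Subsingleton (LinearMap.ker (cokernelMap α β h.linearMap_comp_eq_zero)) := by
  rw [Submodule.subsingleton_iff_eq_bot, cokernelMap, Submodule.ker_liftQ_eq_bot']
  exact h.linearMap_ker_eq.symm

lemma nonempty_ker_cokernelMap_equiv {α : K₂ →ₗ[R] K₁} {β : K₁ →ₗ[R] K₀} (h : β ∘ₗ α = 0)
    {s : Q →ₗ[R] K₁} {t : Q →ₗ[R] A} (hs : Function.Exact s β) (ht : Function.Surjective t)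
    (hst : ∀ x, s x ∈ LinearMap.range α ↔ t x = 0) :
    Nonempty (LinearMap.ker (cokernelMap α β h) ≃ₗ[R] A) := by
  let cycle : Q →ₗ[R] LinearMap.ker (cokernelMap α β h) :=
    ((LinearMap.range α).mkQ ∘ₗ s).codRestrict _ hs.apply_apply_eq_zero
  have cycle_surjective : Function.Surjective cycle := by
    rintro ⟨y, hy⟩
    obtain ⟨y, rfl⟩ := Submodule.Quotient.mk_surjective _ y
    obtain ⟨x, rfl⟩ := (hs y).mp hy
    exact ⟨x, rfl⟩
  refine nonempty_linearEquiv_of_surjective cycle_surjective ht fun x => ?_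
  rw [← hst, Subtype.ext_iff]
  exact Submodule.Quotient.mk_eq_zero _

variable {L₂ L₁ L₀ : Type*} [AddCommGroup L₂] [Module R L₂] [AddCommGroup L₁] [Module R L₁]
  [AddCommGroup L₀] [Module R L₀]

lemma nonempty_ker_cokernelMap_congr {α : K₂ →ₗ[R] K₁} {β : K₁ →ₗ[R] K₀} (h : β ∘ₗ α = 0)
    {α' : L₂ →ₗ[R] L₁} {β' : L₁ →ₗ[R] L₀} (h' : β' ∘ₗ α' = 0)
    (e₂ : K₂ ≃ₗ[R] L₂) (e₁ : K₁ ≃ₗ[R] L₁) (e₀ : K₀ ≃ₗ[R] L₀)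
    (hα : ∀ x, e₁ (α x) = α' (e₂ x)) (hβ : ∀ x, e₀ (β x) = β' (e₁ x)) :
    Nonempty (LinearMap.ker (cokernelMap α β h) ≃ₗ[R] LinearMap.ker (cokernelMap α' β' h')) := by
  have range_map : (LinearMap.range α).map e₁.toLinearMap = LinearMap.range α' := by
    have : e₁.toLinearMap ∘ₗ α = α' ∘ₗ e₂.toLinearMap := LinearMap.ext hα
    rw [← LinearMap.range_comp, this, LinearMap.range_comp, LinearEquiv.range, Submodule.map_top]
  let quotient := Submodule.Quotient.equiv _ _ e₁ range_map
  have ker_comap : LinearMap.ker (cokernelMap α β h) =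
      (LinearMap.ker (cokernelMap α' β' h')).comap quotient.toLinearMap := by
    ext x
    obtain ⟨x, rfl⟩ := Submodule.Quotient.mk_surjective _ x
    change β x = 0 ↔ β' (e₁ x) = 0
    rw [← hβ, LinearEquiv.map_eq_zero_iff]
  exact ⟨(LinearEquiv.ofEq _ _ ker_comap).trans (quotient.ofSubmodule' _)⟩

lemma lcomp_comp_lcomp_eq_zero {α : K₂ →ₗ[R] K₁} {β : K₁ →ₗ[R] K₀} (h : β ∘ₗ α = 0) (Y : Type*)
    [AddCommGroup Y] [Module R Y] : LinearMap.lcomp R Y α ∘ₗ LinearMap.lcomp R Y β = 0 := by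
  ext φ x
  simpa using congrArg φ (LinearMap.congr_fun h x)

end Homology

section Presentation

variable {K₂ K₁ K₀ : Type u} [AddCommGroup K₂] [Module R K₂] [AddCommGroup K₁] [Module R K₁]
  [AddCommGroup K₀] [Module R K₀] (Y : Type u) [AddCommGroup Y] [Module R Y]

lemma nonempty_ker_cokernelMap_lcomp_equiv_reducedExt {α : K₂ →ₗ[R] K₁} {β : K₁ →ₗ[R] K₀}
    (h : β ∘ₗ α = 0) :
    Nonempty (LinearMap.ker (cokernelMap (LinearMap.lcomp R Y β) (LinearMap.lcomp R Y α)
      (lcomp_comp_lcomp_eq_zero h Y)) ≃ₗ[R] reducedExt Y (cokernelMap α β h) 0) := by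
  refine nonempty_ker_cokernelMap_equiv _
    (LinearMap.exact_lcomp_of_exact_of_surjective Y (LinearMap.exact_map_mkQ_range α)
      (Submodule.mkQ_surjective _)) (reducedExtMk_surjective (cokernelMap α β h)) fun φ => ?_
  rw [reducedExtMk_eq_zero_iff, LinearMap.mem_range]
  exact exists_congr fun ψ => ((LinearMap.cancel_right (f := ψ ∘ₗ cokernelMap α β h) (f' := φ)
    (Submodule.mkQ_surjective (LinearMap.range α)))).trans (by simp [eq_comm])

/-- The presentation `K₁ / im α → K₀ → K₀ / im β` obtained from a complex `K₂ → K₁ → K₀`. -/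
def AcyclicPresentation.ofComplex (α : K₂ →ₗ[R] K₁) (β : K₁ →ₗ[R] K₀) (h : β ∘ₗ α = 0)
    (acyclic : ∀ p, Subsingleton (ExtModule R K₀ Y (p + 1))) :
    AcyclicPresentation R Y (K₁ ⧸ LinearMap.range α) K₀ (K₀ ⧸ LinearMap.range β) where
  u := cokernelMap α β h
  π := (LinearMap.range β).mkQ
  exact := exact_cokernelMap_mkQ h
  π_surjective := Submodule.mkQ_surjective _
  acyclic := acyclic

end Presentation

lemma nonempty_homology_succ_equiv (K : ChainComplex (ModuleCat.{u} R) ℕ) (i : ℕ) :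
    Nonempty (K.homology (i + 1) ≃ₗ[R] LinearMap.ker (cokernelMap (K.d (i + 1 + 1) (i + 1)).hom
      (K.d (i + 1) i).hom (by rw [← ModuleCat.hom_comp, K.d_comp_d, ModuleCat.hom_zero]))) := by
  let S := K.sc' (i + 1 + 1) (i + 1) i
  let shortComplex : K.homology (i + 1) ≃ₗ[R] S.homology :=
    (ShortComplex.homologyMapIso (K.isoSc' (i + 1 + 1) (i + 1) i (by simp) (by simp))).toLinearEquiv
  let cycles : S.homology ≃ₗ[R] LinearMap.ker S.g.hom ⧸ LinearMap.range S.moduleCatToCycles :=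
    S.moduleCatHomologyIso.toLinearEquiv
  obtain ⟨model⟩ := nonempty_ker_cokernelMap_equiv (α := S.f.hom) (β := S.g.hom)
    (by rw [← ModuleCat.hom_comp, S.zero, ModuleCat.hom_zero])
    (LinearMap.exact_subtype_ker_map S.g.hom)
    (Submodule.mkQ_surjective (LinearMap.range S.moduleCatToCycles)) fun x => by
      rw [Submodule.mkQ_apply, Submodule.Quotient.mk_eq_zero]
      simp only [LinearMap.mem_range, Subtype.ext_iff]
      rfl
  exact ⟨shortComplex.trans (cycles.trans model.symm)⟩

/-- The identification of `Tor_0` with the tensor product. -/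
def torZeroEquiv (M N : Type u) [AddCommGroup M] [Module R M] [AddCommGroup N] [Module R N] :
    TorModule R M N 0 ≃ₗ[R] M ⊗[R] N :=
  ((Functor.leftDerivedZeroIsoSelf ((MonoidalCategory.tensoringRight (ModuleCat.{u} R)).obj
    (ModuleCat.of R N))).app (ModuleCat.of R M)).toLinearEquiv

/-- A resolution `⋯ → F₂ → F₁ → M → 0` of `M` by finite free modules, continued by `F₀ = 0`: the
shift by one (`F_{i+1}` sits in homological degree `i`) lets degree zero be treated like all other
degrees. -/
structure FiniteFreeResolution (R : Type u) [CommRing R] (M : Type u) [AddCommGroup M]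
    [Module R M] where
  rank : ℕ → ℕ
  rank_zero : rank 0 = 0
  d : ∀ i, (Fin (rank (i + 1)) → R) →ₗ[R] (Fin (rank i) → R)
  ε : (Fin (rank 1) → R) →ₗ[R] M
  ε_surjective : Function.Surjective ε
  exact_zero : Function.Exact (d 1) ε
  exact_succ : ∀ i, Function.Exact (d (i + 2)) (d (i + 1))

namespace FiniteFreeResolution

lemma exists_exact [IsNoetherianRing R] {m : ℕ} {M : Type u} [AddCommGroup M] [Module R M]
    (f : (Fin m → R) →ₗ[R] M) :
    ∃ (k : ℕ) (g : (Fin k → R) →ₗ[R] (Fin m → R)), Function.Exact g f := by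
  obtain ⟨k, g, hg⟩ := Module.Finite.exists_fin' R (LinearMap.ker f)
  refine ⟨k, (LinearMap.ker f).subtype ∘ₗ g, LinearMap.exact_iff.mpr ?_⟩
  rw [LinearMap.range_comp_of_range_eq_top _ (LinearMap.range_eq_top.mpr hg),
    Submodule.range_subtype]

theorem nonempty [IsNoetherianRing R] (M : Type u) [AddCommGroup M] [Module R M]
    [Module.Finite R M] : Nonempty (FiniteFreeResolution R M) := by
  obtain ⟨m, ε, hε⟩ := Module.Finite.exists_fin' R M
  obtain ⟨m₁, d₁, hd₁⟩ := exists_exact ε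
  choose k g hg using fun (x : Σ (m k : ℕ), (Fin k → R) →ₗ[R] (Fin m → R)) =>
    exists_exact x.2.2
  let seq : ℕ → Σ (m k : ℕ), (Fin k → R) →ₗ[R] (Fin m → R) := fun i =>
    Nat.rec ⟨m, m₁, d₁⟩ (fun _ x => ⟨x.2.1, k x, g x⟩) i
  exact ⟨{ rank := fun i => Nat.casesOn i 0 fun i => (seq i).1
           rank_zero := rfl
           d := fun i => Nat.rec 0 (fun i _ => (seq i).2.2) i
           ε := ε
           ε_surjective := hε
           exact_zero := hd₁
           exact_succ := fun i => hg (seq i) }⟩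

variable {M : Type u} [AddCommGroup M] [Module R M] (F : FiniteFreeResolution R M)
  (N : Type u) [AddCommGroup N] [Module R N]

instance : Subsingleton (Fin (F.rank 0) → R) := by
  rw [F.rank_zero]; infer_instance

lemma d_zero : F.d 0 = 0 := Subsingleton.elim _ _

lemma d_comp_d (i : ℕ) : F.d i ∘ₗ F.d (i + 1) = 0 := by
  cases i with
  | zero => rw [d_zero, LinearMap.zero_comp]
  | succ i => exact (F.exact_succ i).linearMap_comp_eq_zero

lemma rTensor_d_comp_d (i : ℕ) :
    LinearMap.rTensor N (F.d i) ∘ₗ LinearMap.rTensor N (F.d (i + 1)) = 0 := by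
  rw [← LinearMap.rTensor_comp, F.d_comp_d, LinearMap.rTensor_zero]

/-- The cokernel of `F_{q+2} → F_{q+1}`. -/
abbrev cokernel (q : ℕ) : Type u :=
  (Fin (F.rank (q + 1)) → R) ⧸ LinearMap.range (F.d (q + 1))

/-- The cokernel of `G^q → G^{q+1}`, for the complex `G = Hom(F, N)`. -/
abbrev homCokernel (q : ℕ) : Type u :=
  ((Fin (F.rank (q + 1)) → R) →ₗ[R] N) ⧸ LinearMap.range (LinearMap.lcomp R N (F.d q))

/-- The cokernel of `K_{q+2} → K_{q+1}`, for the complex `K = F ⊗ N`. -/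
abbrev tensorCokernel (q : ℕ) : Type u :=
  ((Fin (F.rank (q + 1)) → R) ⊗[R] N) ⧸ LinearMap.range (LinearMap.rTensor N (F.d (q + 1)))

/-- The map `homCokernel N q → G^{q+2}`, for the complex `G = Hom(F, N)`. -/
abbrev homMap (q : ℕ) : F.homCokernel N q →ₗ[R] ((Fin (F.rank (q + 2)) → R) →ₗ[R] N) :=
  cokernelMap (LinearMap.lcomp R N (F.d q)) (LinearMap.lcomp R N (F.d (q + 1)))
    (lcomp_comp_lcomp_eq_zero (F.d_comp_d q) N)

/-- The map `tensorCokernel N q → K_q`, for the complex `K = F ⊗ N`. -/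
abbrev tensorMap (q : ℕ) : F.tensorCokernel N q →ₗ[R] ((Fin (F.rank q) → R) ⊗[R] N) :=
  cokernelMap (LinearMap.rTensor N (F.d (q + 1))) (LinearMap.rTensor N (F.d q))
    (F.rTensor_d_comp_d N q)

/-- The augmentation identifies the cokernel of `F₂ → F₁` with `M`. -/
def augmentationEquiv : F.cokernel 0 ≃ₗ[R] M :=
  F.exact_zero.linearEquivOfSurjective F.ε_surjective

/-- The augmentation identifies the cokernel of `F₂ ⊗ N → F₁ ⊗ N` with `M ⊗ N`. -/
def tensorAugmentationEquiv : F.tensorCokernel N 0 ≃ₗ[R] M ⊗[R] N :=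
  (rTensor_exact N F.exact_zero F.ε_surjective).linearEquivOfSurjective
    (LinearMap.rTensor_surjective N F.ε_surjective)

/-- The presentations of the cokernels in the resolution; they compute `Ext(M, Y)`. -/
def presentation (Y : Type u) [AddCommGroup Y] [Module R Y] (q : ℕ) :
    AcyclicPresentation R Y (F.cokernel (q + 1)) (Fin (F.rank (q + 1)) → R) (F.cokernel q) :=
  .ofComplex Y (F.d (q + 2)) (F.d (q + 1)) (F.d_comp_d (q + 1)) fun p =>
    subsingleton_of_projective (Nat.le_add_left 1 p)

lemma nonempty_ext_equiv_reducedExt (q : ℕ) :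
    Nonempty (ExtModule R M N q ≃ₗ[R]
      reducedExt N (cokernelMap (F.d (q + 1)) (F.d q) (F.d_comp_d q)) 0) := by
  cases q with
  | zero => exact ⟨(congrLeft F.augmentationEquiv.symm 0).trans (reducedExtEquiv _ 0).symm⟩
  | succ q =>
    obtain ⟨shift⟩ := AcyclicPresentation.nonempty_ext_zero_equiv_reducedExt_zero
      (C := F.cokernel) (F.presentation N) q
      fun j _ => subsingleton_ker_cokernelMap (F.exact_succ j)
    exact ⟨(congrLeft F.augmentationEquiv.symm (q + 1)).trans shift⟩

theorem nonempty_ker_homMap_equiv_ext (q : ℕ) :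
    Nonempty (LinearMap.ker (F.homMap N q) ≃ₗ[R] ExtModule R M N q) := by
  obtain ⟨ext⟩ := F.nonempty_ext_equiv_reducedExt N q
  obtain ⟨dual⟩ := nonempty_ker_cokernelMap_lcomp_equiv_reducedExt N (F.d_comp_d q)
  exact ⟨dual.trans ext.symm⟩

/-- The complex of a finite free resolution, in its usual degrees. -/
def complex : ChainComplex (ModuleCat.{u} R) ℕ :=
  ChainComplex.of (fun i => ModuleCat.of R (Fin (F.rank (i + 1)) → R))
    (fun i => ModuleCat.ofHom (F.d (i + 1)))
    fun i => by rw [← ModuleCat.ofHom_comp, F.d_comp_d]; rfl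

lemma complex_d (i : ℕ) : F.complex.d (i + 1) i = ModuleCat.ofHom (F.d (i + 1)) := by
  simp [complex]

lemma complex_d_comp_ε : (F.complex.d 1 0 ≫ ModuleCat.ofHom F.ε :
    F.complex.X 1 ⟶ ModuleCat.of R M) = 0 := by
  rw [complex_d]
  exact (ModuleCat.ofHom_comp _ _).symm.trans
    (by rw [F.exact_zero.linearMap_comp_eq_zero]; rfl)

/-- The augmentation as a map of complexes. -/
def augmentation : F.complex ⟶ (ChainComplex.single₀ _).obj (ModuleCat.of R M) :=
  (ChainComplex.toSingle₀Equiv _ _).symm ⟨ModuleCat.ofHom F.ε, F.complex_d_comp_ε⟩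

lemma quasiIsoAt_augmentation_zero : QuasiIsoAt F.augmentation 0 := by
  rw [ChainComplex.quasiIsoAt₀_iff, ShortComplex.quasiIso_iff_of_zeros']
  · refine (ShortComplex.exact_and_epi_g_iff_of_iso ?_).mpr
      ⟨ModuleCat.shortComplex_exact (ModuleCat.shortComplexOfCompEqZero (F.d 1) F.ε
        F.exact_zero.linearMap_comp_eq_zero) F.exact_zero,
        (ModuleCat.epi_iff_surjective _).mpr F.ε_surjective⟩
    exact ShortComplex.isoMk (Iso.refl _) (Iso.refl _) (Iso.refl _)
      ((Category.id_comp _).trans ((F.complex_d 0).symm.trans (Category.comp_id _).symm))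
      ((Category.id_comp _).trans (Eq.trans (ChainComplex.toSingle₀Equiv_symm_apply_f_zero
        (C := F.complex) (X := ModuleCat.of R M) (ModuleCat.ofHom F.ε)
        F.complex_d_comp_ε).symm (Category.comp_id _).symm))
  all_goals rfl

lemma exactAt_complex_succ (i : ℕ) : F.complex.ExactAt (i + 1) := by
  rw [HomologicalComplex.exactAt_iff' _ (i + 1 + 1) (i + 1) i (by simp) (by simp)]
  have exact : Function.Exact (F.complex.d (i + 1 + 1) (i + 1)).hom
      (F.complex.d (i + 1) i).hom := by
    rw [complex_d, complex_d]
    exact F.exact_succ i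
  exact ModuleCat.shortComplex_exact _ exact

/-- A finite free resolution as a projective resolution in the category of modules. -/
def toProjectiveResolution : ProjectiveResolution (ModuleCat.of R M) where
  complex := F.complex
  projective i := inferInstanceAs (Projective (ModuleCat.of R (Fin (F.rank (i + 1)) → R)))
  π := F.augmentation
  quasiIso := ⟨fun i => match i with
    | 0 => F.quasiIsoAt_augmentation_zero
    | i + 1 => (quasiIsoAt_iff_exactAt' _ _ (ChainComplex.exactAt_succ_single_obj _ _)).mpr
        (F.exactAt_complex_succ i)⟩

theorem nonempty_ker_tensorMap_equiv_tor (q : ℕ) :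
    Nonempty (LinearMap.ker (F.tensorMap N q) ≃ₗ[R] TorModule R M N q) := by
  cases q with
  | zero =>
    have : LinearMap.ker (F.tensorMap N 0) = ⊤ := LinearMap.ker_eq_top.mpr (Subsingleton.elim _ _)
    exact ⟨(LinearEquiv.ofTop _ this).trans
      ((F.tensorAugmentationEquiv N).trans (torZeroEquiv M N).symm)⟩
  | succ q =>
    let T := (MonoidalCategory.tensoringRight (ModuleCat.{u} R)).obj (ModuleCat.of R N)
    let K := (T.mapHomologicalComplex (ComplexShape.down ℕ)).obj F.complex
    have differential (i : ℕ) : (K.d (i + 1) i).hom = LinearMap.rTensor N (F.d (i + 1)) := by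
      change (T.map (F.complex.d (i + 1) i)).hom = _
      rw [complex_d]
      rfl
    let derived : TorModule R M N (q + 1) ≃ₗ[R] K.homology (q + 1) :=
      (F.toProjectiveResolution.isoLeftDerivedObj T (q + 1)).toLinearEquiv
    obtain ⟨homology⟩ := nonempty_homology_succ_equiv K q
    obtain ⟨model⟩ := nonempty_ker_cokernelMap_congr _ (F.rTensor_d_comp_d N (q + 1))
      (LinearEquiv.refl R _) (LinearEquiv.refl R _) (LinearEquiv.refl R _)
      (LinearMap.congr_fun (differential (q + 1))) (LinearMap.congr_fun (differential q))
    exact ⟨(derived.trans (homology.trans model)).symm⟩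

end FiniteFreeResolution

section TensorDual

variable {R : Type*} [CommRing R] (N Y : Type*) [AddCommGroup N] [Module R N]
  [AddCommGroup Y] [Module R Y]

/-- The natural isomorphism `F ⊗ Hom(N, Y) ≃ Hom(Hom(F, N), Y)` for the finite free module
`F = R^m`. -/
def tensorDualEquiv (m : ℕ) :
    (Fin m → R) ⊗[R] (N →ₗ[R] Y) ≃ₗ[R] (((Fin m → R) →ₗ[R] N) →ₗ[R] Y) :=
  (TensorProduct.comm R _ _).trans <|
    (TensorProduct.piScalarRight R R (N →ₗ[R] Y) (Fin m)).trans <|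
      (LinearMap.lsum R (fun _ => N) R).trans <|
        (((Pi.basisFun R (Fin m)).constr R).congrLeft Y R)

variable {N Y}

@[simp]
lemma tensorDualEquiv_tmul {m : ℕ} (x : Fin m → R) (φ : N →ₗ[R] Y) (g : (Fin m → R) →ₗ[R] N) :
    tensorDualEquiv N Y m (x ⊗ₜ φ) g = φ (g x) := by
  have expand : g x = ∑ i, x i • g (Pi.single i 1) := by
    conv_lhs => rw [pi_eq_sum_univ' x, map_sum]
    simp
  rw [expand]
  simp [tensorDualEquiv, LinearEquiv.congrLeft, Module.Basis.constr]

lemma tensorDualEquiv_rTensor {m k : ℕ} (f : (Fin m → R) →ₗ[R] (Fin k → R))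
    (x : (Fin m → R) ⊗[R] (N →ₗ[R] Y)) :
    tensorDualEquiv N Y k (LinearMap.rTensor _ f x) =
      LinearMap.lcomp R Y (LinearMap.lcomp R N f) (tensorDualEquiv N Y m x) := by
  induction x with
  | zero => simp
  | tmul x φ => ext g; simp
  | add x y hx hy => simp only [map_add, hx, hy]

end TensorDual

namespace ExtModule

variable {N Y : Type u} [AddCommGroup N] [Module R N] [AddCommGroup Y] [Module R Y]

lemma subsingleton_pi (m p : ℕ) [Subsingleton (ExtModule R N Y p)] :
    Subsingleton (ExtModule R (Fin m → N) Y p) := by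
  induction m with
  | zero => exact subsingleton_of_subsingleton p
  | succ m ih =>
    have : Subsingleton (ExtModule R (N × (Fin m → N)) Y p) :=
      subsingleton_middle LinearMap.inl_injective (Function.Exact.inl_snd (R := R))
        LinearMap.snd_surjective p
    exact (congrLeft (Fin.consLinearEquiv R fun _ : Fin (m + 1) => N) p).symm.toEquiv.subsingleton

lemma subsingleton_fin_hom (m p : ℕ) [Subsingleton (ExtModule R N Y p)] :
    Subsingleton (ExtModule R ((Fin m → R) →ₗ[R] N) Y p) :=
  have := subsingleton_pi (R := R) (N := N) (Y := Y) m p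
  (congrLeft ((Pi.basisFun R (Fin m)).constr R) p).symm.toEquiv.subsingleton

lemma subsingleton_fin_tensor (m p : ℕ) [Subsingleton (ExtModule R N Y p)] :
    Subsingleton (ExtModule R ((Fin m → R) ⊗[R] N) Y p) :=
  have := subsingleton_pi (R := R) (N := N) (Y := Y) m p
  (congrLeft ((TensorProduct.comm R _ _).trans (TensorProduct.piScalarRight R R N (Fin m)))
    p).toEquiv.subsingleton

end ExtModule

namespace FiniteFreeResolution

variable {M : Type u} [AddCommGroup M] [Module R M] (F : FiniteFreeResolution R M)
  (N Y : Type u) [AddCommGroup N] [Module R N] [AddCommGroup Y] [Module R Y]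

theorem nonempty_reducedExt_homMap_equiv_tor (q : ℕ) :
    Nonempty (reducedExt Y (F.homMap N q) 0 ≃ₗ[R] TorModule R M (N →ₗ[R] Y) q) := by
  obtain ⟨dual⟩ := nonempty_ker_cokernelMap_lcomp_equiv_reducedExt Y
    (lcomp_comp_lcomp_eq_zero (F.d_comp_d q) N)
  obtain ⟨tor⟩ := F.nonempty_ker_tensorMap_equiv_tor (N →ₗ[R] Y) q
  obtain ⟨compare⟩ := nonempty_ker_cokernelMap_congr (F.rTensor_d_comp_d (N →ₗ[R] Y) q)
    (lcomp_comp_lcomp_eq_zero (lcomp_comp_lcomp_eq_zero (F.d_comp_d q) N) Y)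
    (tensorDualEquiv N Y _) (tensorDualEquiv N Y _) (tensorDualEquiv N Y _)
    (tensorDualEquiv_rTensor _) (tensorDualEquiv_rTensor _)
  exact ⟨dual.symm.trans (compare.symm.trans tor)⟩

theorem nonempty_reducedExt_tensorMap_equiv_ext (q : ℕ) :
    Nonempty (reducedExt Y (F.tensorMap N q) 0 ≃ₗ[R] ExtModule R M (N →ₗ[R] Y) q) := by
  obtain ⟨dual⟩ := nonempty_ker_cokernelMap_lcomp_equiv_reducedExt Y (F.rTensor_d_comp_d N q)
  obtain ⟨ext⟩ := F.nonempty_ker_homMap_equiv_ext (N →ₗ[R] Y) q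
  let curry (m : ℕ) : ((Fin m → R) ⊗[R] N →ₗ[R] Y) ≃ₗ[R] ((Fin m → R) →ₗ[R] N →ₗ[R] Y) :=
    (TensorProduct.lift.equiv (RingHom.id R) (Fin m → R) N Y).symm
  have curry_lcomp {m k : ℕ} (f : (Fin m → R) →ₗ[R] (Fin k → R)) (φ) :
      curry m (LinearMap.lcomp R Y (LinearMap.rTensor N f) φ) =
        LinearMap.lcomp R (N →ₗ[R] Y) f (curry k φ) := by
    ext; simp [curry]
  obtain ⟨compare⟩ := nonempty_ker_cokernelMap_congr
    (lcomp_comp_lcomp_eq_zero (F.rTensor_d_comp_d N q) Y)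
    (lcomp_comp_lcomp_eq_zero (F.d_comp_d q) (N →ₗ[R] Y))
    (curry _) (curry _) (curry _) (curry_lcomp _) (curry_lcomp _)
  exact ⟨dual.symm.trans (compare.trans ext)⟩

variable {Y} (hN : ∀ p, Subsingleton (ExtModule R N Y (p + 1)))

/-- The presentations of the cokernels in `Hom(F, N)`. -/
def homPresentation (q : ℕ) : AcyclicPresentation R Y (F.homCokernel N q)
    ((Fin (F.rank (q + 2)) → R) →ₗ[R] N) (F.homCokernel N (q + 1)) :=
  .ofComplex Y _ _ (lcomp_comp_lcomp_eq_zero (F.d_comp_d q) N) fun p =>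
    have := hN p
    subsingleton_fin_hom _ (p + 1)

/-- The presentations of the cokernels in `F ⊗ N`. -/
def tensorPresentation (q : ℕ) : AcyclicPresentation R Y (F.tensorCokernel N (q + 1))
    ((Fin (F.rank (q + 1)) → R) ⊗[R] N) (F.tensorCokernel N q) :=
  .ofComplex Y _ _ (F.rTensor_d_comp_d N (q + 1)) fun p =>
    have := hN p
    subsingleton_fin_tensor _ (p + 1)

end FiniteFreeResolution

section HomDuality

variable [IsNoetherianRing R] {M N Y : Type u} [AddCommGroup M] [Module R M] [Module.Finite R M]
  [AddCommGroup N] [Module R N] [Module.Finite R N] [AddCommGroup Y] [Module R Y] {d : ℕ}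
  (hY : ExtVanishesAbove R Y d) (hN : ∀ p, Subsingleton (ExtModule R N Y (p + 1)))

include hY hN

theorem nonempty_tor_hom_equiv_ext_ext {q e : ℕ} (he : e = q + d)
    (hMN : ∀ j, q ≤ j → j < e → Subsingleton (ExtModule R M N j)) :
    Nonempty (TorModule R M (N →ₗ[R] Y) q ≃ₗ[R] ExtModule R (ExtModule R M N e) Y d) := by
  obtain ⟨F⟩ := FiniteFreeResolution.nonempty (R := R) M
  obtain ⟨tor⟩ := F.nonempty_reducedExt_homMap_equiv_tor N Y q
  have ext j := (F.nonempty_ker_homMap_equiv_ext N j).some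
  obtain ⟨shift⟩ := AcyclicPresentation.nonempty_reducedExt_zero_equiv_ext_ker
    (R := R) (C := F.homCokernel N) (F.homPresentation N hN) hY he fun j h₁ h₂ => by
      have := hMN j h₁ h₂
      exact (ext j).toEquiv.subsingleton
  exact ⟨tor.symm.trans (shift.trans (congrLeft (ext e) d))⟩

theorem subsingleton_tor_hom {q : ℕ}
    (hMN : ∀ j, q ≤ j → j ≤ q + d → Subsingleton (ExtModule R M N j)) :
    Subsingleton (TorModule R M (N →ₗ[R] Y) q) := by
  obtain ⟨equiv⟩ := nonempty_tor_hom_equiv_ext_ext hY hN rfl fun j h₁ h₂ => hMN j h₁ h₂.le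
  have := hMN (q + d) (by lia) le_rfl
  exact equiv.toEquiv.subsingleton

theorem nonempty_tor_hom_equiv_hom_ext {q : ℕ}
    (hMN : ∀ j, q < j → j ≤ q + d → Subsingleton (ExtModule R M N j)) :
    Nonempty (TorModule R M (N →ₗ[R] Y) q ≃ₗ[R] (ExtModule R M N q →ₗ[R] Y)) := by
  obtain ⟨F⟩ := FiniteFreeResolution.nonempty (R := R) M
  obtain ⟨tor⟩ := F.nonempty_reducedExt_homMap_equiv_tor N Y q
  have ext j := (F.nonempty_ker_homMap_equiv_ext N j).some
  obtain ⟨restrict⟩ := AcyclicPresentation.nonempty_reducedExt_zero_equiv_dual_ker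
    (R := R) (C := F.homCokernel N) (F.homPresentation N hN) hY fun j h₁ h₂ => by
      have := hMN j h₁ h₂
      exact (ext j).toEquiv.subsingleton
  exact ⟨tor.symm.trans (restrict.trans ((ext q).congrLeft Y R))⟩

theorem nonempty_tensor_hom_equiv_hom_hom
    (hMN : ∀ j, 0 < j → j ≤ d → Subsingleton (ExtModule R M N j)) :
    Nonempty (M ⊗[R] (N →ₗ[R] Y) ≃ₗ[R] ((M →ₗ[R] N) →ₗ[R] Y)) := by
  obtain ⟨dual⟩ := nonempty_tor_hom_equiv_hom_ext hY hN (q := 0) fun j h₁ h₂ =>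
    hMN j h₁ (by lia)
  exact ⟨(torZeroEquiv M _).symm.trans (dual.trans ((zeroEquiv M N).congrLeft Y R))⟩

theorem existsExactSeqToZero_tor_hom {q e : ℕ} (he : e = q + d)
    (hMN : ∀ j, q ≤ j → j < e → Subsingleton (ExtModule R M N j)) :
    ExistsExactSeqToZero R (TorModule R M (N →ₗ[R] Y) (q + 2))
      (extInt R (ExtModule R M N e) Y ((d : ℤ) - 2)) (ExtModule R (ExtModule R M N (e + 1)) Y d)
      (TorModule R M (N →ₗ[R] Y) (q + 1)) (extInt R (ExtModule R M N e) Y ((d : ℤ) - 1)) := by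
  obtain ⟨F⟩ := FiniteFreeResolution.nonempty (R := R) M
  have tor j := (F.nonempty_reducedExt_homMap_equiv_tor N Y j).some
  have ext j := (F.nonempty_ker_homMap_equiv_ext N j).some
  have sequence := AcyclicPresentation.existsExactSeqToZero
    (R := R) (C := F.homCokernel N) (F.homPresentation N hN) hY he fun j h₁ h₂ => by
      have := hMN j h₁ h₂
      exact (ext j).toEquiv.subsingleton
  exact sequence.congr (tor _) (extIntCongrLeft (ext e) _) (congrLeft (ext (e + 1)) d) (tor _)
    (extIntCongrLeft (ext e) _)

end HomDuality

section TensorDuality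

variable [IsNoetherianRing R] {M N Y : Type u} [AddCommGroup M] [Module R M] [Module.Finite R M]
  [AddCommGroup N] [Module R N] [AddCommGroup Y] [Module R Y]
  (hN : ∀ p, Subsingleton (ExtModule R N Y (p + 1)))

include hN

theorem nonempty_ext_tensor_equiv_ext_hom {i : ℕ}
    (hMN : ∀ j, 1 ≤ j → j ≤ i → Subsingleton (TorModule R M N j)) :
    Nonempty (ExtModule R (M ⊗[R] N) Y i ≃ₗ[R] ExtModule R M (N →ₗ[R] Y) i) := by
  obtain ⟨F⟩ := FiniteFreeResolution.nonempty (R := R) M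
  cases i with
  | zero =>
    exact ⟨(zeroEquiv _ Y).trans <|
      (TensorProduct.lift.equiv (RingHom.id R) M N Y).symm.trans (zeroEquiv M _).symm⟩
  | succ i =>
    have tor j := (F.nonempty_ker_tensorMap_equiv_tor N j).some
    obtain ⟨ext⟩ := F.nonempty_reducedExt_tensorMap_equiv_ext N Y (i + 1)
    obtain ⟨shift⟩ := AcyclicPresentation.nonempty_ext_zero_equiv_reducedExt_zero
      (R := R) (C := F.tensorCokernel N) (F.tensorPresentation N hN) i fun j hj => by
        have := hMN (j + 1) (by lia) (by lia)
        exact (tor (j + 1)).toEquiv.subsingleton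
    exact ⟨(congrLeft (F.tensorAugmentationEquiv N) (i + 1)).symm.trans (shift.trans ext)⟩

variable [Module.Finite R N] {d e : ℕ} (hY : ExtVanishesAbove R Y d)
  (hMN : ∀ j, 1 ≤ j → j ≤ e → Subsingleton (TorModule R M N j))

include hY hMN

theorem subsingleton_ext_hom {k : ℕ} (hdk : d < k) (hke : k ≤ e) :
    Subsingleton (ExtModule R M (N →ₗ[R] Y) k) := by
  obtain ⟨equiv⟩ := nonempty_ext_tensor_equiv_ext_hom hN fun j h₁ h₂ => hMN j h₁ (h₂.trans hke)
  have := hY (M ⊗[R] N) k hdk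
  exact equiv.symm.toEquiv.subsingleton

variable (hde : d ≤ e)

include hde

theorem nonempty_hom_tor_equiv_ext_hom :
    Nonempty ((TorModule R M N (e + 1) →ₗ[R] Y) ≃ₗ[R] ExtModule R M (N →ₗ[R] Y) (e + 1)) := by
  obtain ⟨F⟩ := FiniteFreeResolution.nonempty (R := R) M
  have tor j := (F.nonempty_ker_tensorMap_equiv_tor N j).some
  obtain ⟨ext⟩ := F.nonempty_reducedExt_tensorMap_equiv_ext N Y (e + 1)
  obtain ⟨restrict⟩ := AcyclicPresentation.nonempty_reducedExt_equiv_ext_ker_of_dim_le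
    (R := R) (C := F.tensorCokernel N) (F.tensorPresentation N hN) hY
    (fun j hj => by
      have := hMN (j + 1) (by lia) (by lia)
      exact (tor (j + 1)).toEquiv.subsingleton) hde 0
  exact ⟨(zeroEquiv _ Y).symm.trans <| (congrLeft (tor (e + 1)) 0).symm.trans <|
    restrict.symm.trans ext⟩

theorem existsExactSeqFromZero_ext_hom :
    ExistsExactSeqFromZero R (ExtModule R (TorModule R M N (e + 1)) Y 1)
      (ExtModule R M (N →ₗ[R] Y) (e + 2)) (TorModule R M N (e + 2) →ₗ[R] Y)
      (ExtModule R (TorModule R M N (e + 1)) Y 2) (ExtModule R M (N →ₗ[R] Y) (e + 3)) := by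
  obtain ⟨F⟩ := FiniteFreeResolution.nonempty (R := R) M
  have tor j := (F.nonempty_ker_tensorMap_equiv_tor N j).some
  have ext j := (F.nonempty_reducedExt_tensorMap_equiv_ext N Y j).some
  have sequence := AcyclicPresentation.existsExactSeqFromZero
    (R := R) (C := F.tensorCokernel N) (F.tensorPresentation N hN) hY
    (fun j hj => by
      have := hMN (j + 1) (by lia) (by lia)
      exact (tor (j + 1)).toEquiv.subsingleton) hde
  exact sequence.congr (congrLeft (tor (e + 1)) 1) (ext (e + 2)) ((tor (e + 2)).congrLeft Y R)
    (congrLeft (tor (e + 1)) 2) (ext (e + 3))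

end TensorDuality

section Depth

open IsLocalRing RingTheory.Sequence Pointwise

variable [IsLocalRing R] {X Y : Type u} [AddCommGroup X] [Module R X] [AddCommGroup Y] [Module R Y]

lemma exists_isRegular_of_moduleDepth_eq [Nontrivial X] {d : ℕ} (h : moduleDepth R X = d) :
    ∃ rs : List R, rs.length = d ∧ (∀ r ∈ rs, r ∈ maximalIdeal R) ∧ IsRegular X rs := by
  have : Nonempty {rs : List R // (∀ r ∈ rs, r ∈ maximalIdeal R) ∧ IsRegular X rs} :=
    ⟨⟨[], by simp, IsRegular.nil R X⟩⟩
  unfold moduleDepth at h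
  obtain ⟨⟨rs, hrs, hreg⟩, hlen⟩ := ENat.exists_eq_iSup_of_lt_top (h ▸ ENat.natCast_lt_top d)
  exact ⟨rs, by exact_mod_cast hlen.trans h, hrs, hreg⟩

lemma length_le_moduleDepth {rs : List R} (hrs : ∀ r ∈ rs, r ∈ maximalIdeal R)
    (hreg : IsRegular X rs) : (rs.length : ℕ∞) ≤ moduleDepth R X :=
  le_iSup (fun rs : {rs : List R // (∀ r ∈ rs, r ∈ maximalIdeal R) ∧ IsRegular X rs} =>
    (rs.1.length : ℕ∞)) ⟨rs, hrs, hreg⟩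

lemma subsingleton_of_smul_surjective [Module.Finite R X] {r : R} (hr : r ∈ maximalIdeal R)
    (hsurj : Function.Surjective fun x : X => r • x) : Subsingleton X := by
  have top_le : (⊤ : Submodule R X) ≤ maximalIdeal R • ⊤ := fun x _ => by
    obtain ⟨y, rfl⟩ := hsurj x
    exact Submodule.smul_mem_smul hr trivial
  have top_eq_bot := Submodule.eq_bot_of_le_smul_of_le_jacobson_bot _ _ Module.Finite.fg_top top_le
    (maximalIdeal_le_jacobson _)
  exact (Submodule.subsingleton_iff R).mp (subsingleton_of_bot_eq_top top_eq_bot.symm)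

variable [IsNoetherianRing R]

lemma subsingleton_ext_of_quotSMulTop [Module.Finite R X] [Module.Finite R Y] {r : R}
    (hr : r ∈ maximalIdeal R) (hreg : IsSMulRegular X r) (i : ℕ)
    [Subsingleton (ExtModule R (QuotSMulTop r X) Y (i + 1))] :
    Subsingleton (ExtModule R X Y i) := by
  have : Module.Finite R (ModuleCat.of R X) := ‹Module.Finite R X›
  have : Module.Finite R (ModuleCat.of R Y) := ‹Module.Finite R Y›
  refine subsingleton_of_smul_surjective hr fun x => ?_
  obtain ⟨y, hy⟩ := precomp_surjective (Y := Y) (f := LinearMap.lsmul R X r) hreg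
    (LinearMap.exact_lsmul_mkQ_smul_top X r) (Submodule.mkQ_surjective _) i x
  exact ⟨y, (precomp_lsmul r i y).symm.trans hy⟩

lemma ExtVanishesAbove.subsingleton_of_isWeaklyRegular [Module.Finite R X] [Module.Finite R Y]
    {d : ℕ} (hY : ExtVanishesAbove R Y d) {rs : List R} (hrs : ∀ r ∈ rs, r ∈ maximalIdeal R)
    (hreg : IsWeaklyRegular X rs) {i : ℕ} (hi : d < i + rs.length) :
    Subsingleton (ExtModule R X Y i) := by
  induction rs generalizing X i with
  | nil => exact hY X i hi
  | cons r rs ih =>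
    rw [isWeaklyRegular_cons_iff] at hreg
    rw [List.length_cons] at hi
    have := ih (fun s hs => hrs s (by simp [hs])) hreg.2 (i := i + 1) (by lia)
    exact subsingleton_ext_of_quotSMulTop (hrs r (by simp)) hreg.1 i

omit [IsLocalRing R] [IsNoetherianRing R] in
lemma subsingleton_ext_quotient_of_isWeaklyRegular {rs : List R} (hreg : IsWeaklyRegular X rs)
    {t : ℕ} (hX : ∀ i, t < i → Subsingleton (ExtModule R X Y i)) {i : ℕ}
    (hi : t + rs.length < i) :
    Subsingleton (ExtModule R (X ⧸ (Ideal.ofList rs • ⊤ : Submodule R X)) Y i) := by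
  induction rs generalizing X t with
  | nil =>
    have := hX i (by simpa using hi)
    exact (congrLeft (Submodule.quotEquivOfEqBot (Ideal.ofList [] • ⊤ : Submodule R X)
      (by rw [Ideal.ofList_nil, Submodule.bot_smul])) i).toEquiv.subsingleton
  | cons r rs ih =>
    rw [isWeaklyRegular_cons_iff] at hreg
    rw [List.length_cons] at hi
    have hquot (j : ℕ) (hj : t + 1 < j) : Subsingleton (ExtModule R (QuotSMulTop r X) Y j) := by
      obtain ⟨j, rfl⟩ := Nat.exists_eq_add_of_le' (show 1 ≤ j by lia)
      have := hX j (by lia)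
      have := hX (j + 1) (by lia)
      exact subsingleton_right (f := LinearMap.lsmul R X r) hreg.1
        (LinearMap.exact_lsmul_mkQ_smul_top X r) (Submodule.mkQ_surjective _) j
    have := ih hreg.2 hquot (by lia)
    exact (congrLeft (Submodule.quotOfListConsSMulTopEquivQuotSMulTopInner X r rs)
      i).toEquiv.subsingleton

lemma exists_residueField_injective_of_moduleDepth_eq_length [Module.Finite R X] {rs : List R}
    (hrs : ∀ r ∈ rs, r ∈ maximalIdeal R) (hreg : IsRegular X rs)
    (hdepth : moduleDepth R X = rs.length) :
    ∃ f : ResidueField R →ₗ[R] (X ⧸ (Ideal.ofList rs • ⊤ : Submodule R X)),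
      Function.Injective f := by
  have : IsSimpleModule R (ResidueField R) :=
    isSimpleModule_iff_isCoatom.mpr (Ideal.isMaximal_def.mp inferInstance)
  by_contra! not_injective
  have hom_subsingleton :
      Subsingleton (ResidueField R →ₗ[R] (X ⧸ (Ideal.ofList rs • ⊤ : Submodule R X))) :=
    subsingleton_of_forall_eq 0 fun f =>
      (LinearMap.injective_or_eq_zero f).resolve_left (not_injective f)
  obtain ⟨r, hr, hreg_r⟩ := IsSMulRegular.subsingleton_linearMap_iff.mp hom_subsingleton
  have hr : r ∈ maximalIdeal R := by rwa [← Ideal.annihilator_quotient (I := maximalIdeal R)]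
  have hrs' : ∀ s ∈ rs ++ [r], s ∈ maximalIdeal R := by
    simpa [or_imp, forall_and] using ⟨hrs, hr⟩
  have : Nontrivial X := hreg.nontrivial
  have hreg' : IsRegular X (rs ++ [r]) :=
    (isRegular_iff_isWeaklyRegular_of_subset_maximalIdeal hrs').mpr <|
      (isWeaklyRegular_append_iff X rs [r]).mpr
        ⟨hreg.1, (isWeaklyRegular_singleton_iff _ r).mpr hreg_r⟩
  have := length_le_moduleDepth hrs' hreg'
  rw [hdepth, List.length_append, List.length_singleton] at this
  norm_cast at this
  lia

lemma isSMulRegular_quotient_of_notMem {S : Type*} [CommRing S] {p : Ideal S} [p.IsPrime] {x : S}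
    (hx : x ∉ p) : IsSMulRegular (S ⧸ p) x := by
  have : Ideal.Quotient.mk p x ≠ 0 := by rwa [Ne, Ideal.Quotient.eq_zero_iff_mem]
  exact fun a b hab => mul_left_cancel₀ this hab

lemma ExtVanishesAbove.of_subsingleton_ext_residueField [Module.Finite R Y] {n : ℕ}
    (hY : ExtVanishesAbove R Y (n + 1))
    [Subsingleton (ExtModule R (ResidueField R) Y (n + 1))] : ExtVanishesAbove R Y n := by
  intro X _ _ hX q hq
  obtain rfl | hq : q = n + 1 ∨ n + 1 < q := by lia
  swap
  · exact hY X q hq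
  induction hX using IsNoetherianRing.induction_on_isQuotientEquivQuotientPrime R with
  | subsingleton => exact subsingleton_of_subsingleton (n + 1)
  | quotient X p e =>
    suffices Subsingleton (ExtModule R (R ⧸ p.asIdeal) Y (n + 1)) from
      (congrLeft e (n + 1)).toEquiv.subsingleton
    rcases eq_or_ne p.asIdeal (maximalIdeal R) with hp | hp
    · rw [hp]
      exact ‹Subsingleton (ExtModule R (ResidueField R) Y (n + 1))›
    · obtain ⟨x, hx, hxp⟩ := SetLike.exists_of_lt (lt_of_le_of_ne (le_maximalIdeal p.2.ne_top) hp)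
      have := hY (QuotSMulTop x (R ⧸ p.asIdeal)) (n + 2) (by lia)
      exact subsingleton_ext_of_quotSMulTop hx (isSMulRegular_quotient_of_notMem hxp) (n + 1)
  | exact X₁ X₂ X₃ f g hf hg hfg h₁ h₃ => exact subsingleton_middle hf hfg hg (n + 1)

theorem extVanishesAbove_of_hasInjectiveDimensionLE [Module.Finite R Y] {d : ℕ}
    (hR : moduleDepth R R = d) (hY : ∃ n : ℕ, HasInjectiveDimensionLE (ModuleCat.of R Y) n) :
    ExtVanishesAbove R Y d := by
  obtain ⟨rs, hlen, hrs, hreg⟩ := exists_isRegular_of_moduleDepth_eq hR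
  obtain ⟨f, hf⟩ :=
    exists_residueField_injective_of_moduleDepth_eq_length hrs hreg (by rw [hR, hlen])
  have descent (n : ℕ) (hn : d ≤ n) (h : ExtVanishesAbove R Y (n + 1)) :
      ExtVanishesAbove R Y n := by
    have := subsingleton_ext_quotient_of_isWeaklyRegular (Y := Y) hreg.1 (t := 0)
      (fun i hi => subsingleton_of_projective hi) (i := n + 1) (by lia)
    have := h (_ ⧸ LinearMap.range f) (n + 2) (by lia)
    have : Subsingleton (ExtModule R (ResidueField R) Y (n + 1)) :=
      subsingleton_left hf (LinearMap.exact_map_mkQ_range f) (Submodule.mkQ_surjective _) (n + 1)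
    exact h.of_subsingleton_ext_residueField
  obtain ⟨m, hm⟩ := hY
  have above_injectiveDimension : ExtVanishesAbove R Y (m + d) := fun X _ _ _ p hp =>
    HasInjectiveDimensionLT.subsingleton _ (m + 1) p (by lia) _
  exact Nat.decreasingInduction' (P := ExtVanishesAbove R Y) (fun n _ hn => descent n hn)
    (Nat.le_add_left d m) above_injectiveDimension

lemma subsingleton_ext_residueField_of_isRegular [Module.Finite R X] {rs : List R}
    (hrs : ∀ r ∈ rs, r ∈ maximalIdeal R) (hreg : IsRegular X rs) {i : ℕ} (hi : i < rs.length) :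
    Subsingleton (ExtModule R (ResidueField R) X i) := by
  have : Nontrivial X := hreg.nontrivial
  have : Module.Finite R (ModuleCat.of R X) := ‹Module.Finite R X›
  have : Module.Finite R (ModuleCat.of R (ResidueField R)) :=
    inferInstanceAs (Module.Finite R (ResidueField R))
  refine ModuleCat.subsingleton_ext_of_exists_isRegular (maximalIdeal R)
    (ModuleCat.of R (ResidueField R)) ?_ (ModuleCat.of R X) ?_ rs hrs hreg i hi
  · change Module.support R (R ⧸ maximalIdeal R) ⊆ _
    rw [Module.support_eq_zeroLocus, Ideal.annihilator_quotient]
  · exact lt_top_iff_ne_top.mpr (Submodule.top_ne_ideal_smul_of_le_jacobson_annihilator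
      (maximalIdeal_le_jacobson _)).symm

end Depth

section RegularSequencesOnHom

open RingTheory.Sequence Pointwise

variable {A B C : Type u} [AddCommGroup A] [Module R A] [AddCommGroup B] [Module R B]
  [AddCommGroup C] [Module R C]

lemma quotSMulTop_map_injective {f : A →ₗ[R] B} {g : B →ₗ[R] C} (hf : Function.Injective f)
    (hfg : Function.Exact f g) {r : R} (hC : IsSMulRegular C r) :
    Function.Injective (QuotSMulTop.map r f) := by
  have hzero : Function.Exact (0 : PUnit.{u + 1} →ₗ[R] A) f :=
    (LinearMap.exact_zero_iff_injective _ f).mpr hf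
  have := QuotSMulTop.map_first_exact_on_four_term_exact_of_isSMulRegular_last hzero hfg hC
  rwa [map_zero, LinearMap.exact_zero_iff_injective] at this

lemma isWeaklyRegular_dropLast {rs : List R} (h : IsWeaklyRegular A rs) :
    IsWeaklyRegular A rs.dropLast := by
  rcases List.eq_nil_or_concat rs with rfl | ⟨rs, r, rfl⟩
  · exact h
  · rw [List.concat_eq_append, isWeaklyRegular_append_iff] at h
    simpa only [List.concat_eq_append, List.dropLast_concat] using h.1

lemma isWeaklyRegular_of_isWeaklyRegular_dropLast {f : A →ₗ[R] B} {g : B →ₗ[R] C}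
    (hf : Function.Injective f) (hfg : Function.Exact f g) (hg : Function.Surjective g)
    {rs : List R} (hB : IsWeaklyRegular B rs) (hC : IsWeaklyRegular C rs.dropLast) :
    IsWeaklyRegular A rs := by
  induction rs generalizing A B C with
  | nil => exact IsWeaklyRegular.nil R A
  | cons r rs ih =>
    rw [isWeaklyRegular_cons_iff] at hB ⊢
    refine ⟨hB.1.of_injective f hf, ?_⟩
    cases rs with
    | nil => exact IsWeaklyRegular.nil R _
    | cons s rs =>
      rw [List.dropLast_cons_cons, isWeaklyRegular_cons_iff] at hC
      exact ih (quotSMulTop_map_injective hf hfg hC.1) (QuotSMulTop.map_exact r hfg hg)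
        (QuotSMulTop.map_surjective r hg) hB.2 hC.2

lemma isWeaklyRegular_hom_pi {ι : Type*} [Finite ι] {rs : List R} (h : IsWeaklyRegular B rs) :
    IsWeaklyRegular ((ι → R) →ₗ[R] B) rs := by
  classical
  have := Fintype.ofFinite ι
  exact (((TensorProduct.piScalarRight R R B ι).trans
    ((Pi.basisFun R ι).constr R)).isWeaklyRegular_congr rs).mp h.isWeaklyRegular_rTensor

lemma lcomp_surjective_of_subsingleton_ext {f : A →ₗ[R] B} {g : B →ₗ[R] C}
    (hf : Function.Injective f) (hfg : Function.Exact f g) (hg : Function.Surjective g)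
    (Y : Type u) [AddCommGroup Y] [Module R Y] [Subsingleton (ExtModule R C Y 1)] :
    Function.Surjective (LinearMap.lcomp R Y f) := by
  intro φ
  obtain ⟨x, hx⟩ := precomp_surjective hf hfg hg 0 ((zeroEquiv A Y).symm φ)
  obtain ⟨ψ, rfl⟩ := (zeroEquiv B Y).symm.surjective x
  rw [precomp_zeroEquiv_symm] at hx
  exact ⟨ψ, (zeroEquiv A Y).symm.injective hx⟩

theorem isWeaklyRegular_hom [IsNoetherianRing R] [Module.Finite R A] {rs : List R}
    (hB : IsWeaklyRegular B rs)
    (hAB : ∀ j, 1 ≤ j → j < rs.length → Subsingleton (ExtModule R A B j)) :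
    IsWeaklyRegular (A →ₗ[R] B) rs := by
  obtain ⟨t, ht⟩ : ∃ t, rs.length = t := ⟨_, rfl⟩
  induction t generalizing A rs with
  | zero => rw [List.length_eq_zero_iff.mp ht]; exact IsWeaklyRegular.nil R _
  | succ t ih =>
    obtain ⟨m, g, hg⟩ := Module.Finite.exists_fin' R A
    have hker := Submodule.subtype_injective (LinearMap.ker g)
    have hexact := LinearMap.exact_subtype_ker_map g
    have hfree : IsWeaklyRegular ((Fin m → R) →ₗ[R] B) rs := isWeaklyRegular_hom_pi hB
    have hinj := LinearMap.lcomp_injective_of_surjective (S := R) (N := B) g hg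
    rcases t with _ | t
    · obtain ⟨r, rfl⟩ := List.length_eq_one_iff.mp ht
      rw [isWeaklyRegular_singleton_iff] at hfree ⊢
      exact hfree.of_injective _ hinj
    have := hAB 1 le_rfl (by lia)
    refine isWeaklyRegular_of_isWeaklyRegular_dropLast hinj
      (LinearMap.exact_lcomp_of_exact_of_surjective B hexact hg)
      (lcomp_surjective_of_subsingleton_ext hker hexact hg B) hfree ?_
    refine ih (isWeaklyRegular_dropLast hB) (fun j hj hjt => ?_) (by simp [ht])
    rw [List.length_dropLast] at hjt
    have := hAB (j + 1) (by lia) (by lia)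
    have := subsingleton_of_projective (A := Fin m → R) (Y := B) (R := R) hj
    exact subsingleton_left hker hexact hg j

end RegularSequencesOnHom

section MaximalCohenMacaulay

open IsLocalRing RingTheory.Sequence

variable [IsLocalRing R] {X Y : Type u} [AddCommGroup X] [Module R X] [AddCommGroup Y] [Module R Y]

lemma length_le_supportDim_of_isRegular [IsNoetherianRing R] [Module.Finite R X] {rs : List R}
    (hreg : IsRegular X rs) : (rs.length : WithBot ℕ∞) ≤ Module.supportDim R X := by
  have := hreg.quot_ofList_smul_nontrivial ⊤
  rw [← Module.supportDim_add_length_eq_supportDim_of_isRegular rs hreg]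
  have : Nonempty (Module.support R (X ⧸ (Ideal.ofList rs • ⊤ : Submodule R X))) :=
    Module.nonempty_support_of_nontrivial.to_subtype
  exact le_add_of_nonneg_left Order.krullDim_nonneg

lemma IsMaximalCohenMacaulay.moduleDepth_eq (hX : IsMaximalCohenMacaulay R X) {d : ℕ}
    (hd : ringKrullDim R = d) : moduleDepth R X = d := by
  have := hX.depth_eq
  rw [hX.dim_eq, hd] at this
  exact_mod_cast this

theorem isMaximalCohenMacaulay_iff_exists_isWeaklyRegular [IsNoetherianRing R] [Module.Finite R X]
    [Nontrivial X] {d : ℕ} (hd : ringKrullDim R = d) :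
    IsMaximalCohenMacaulay R X ↔
      ∃ rs : List R, rs.length = d ∧ (∀ r ∈ rs, r ∈ maximalIdeal R) ∧ IsWeaklyRegular X rs := by
  constructor
  · intro hX
    obtain ⟨rs, hlen, hrs, hreg⟩ := exists_isRegular_of_moduleDepth_eq (hX.moduleDepth_eq hd)
    exact ⟨rs, hlen, hrs, hreg.1⟩
  · rintro ⟨rs, rfl, hrs, hweak⟩
    have hreg : IsRegular X rs :=
      (isRegular_iff_isWeaklyRegular_of_subset_maximalIdeal hrs).mpr hweak
    have hdim : Module.supportDim R X = rs.length :=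
      le_antisymm ((Module.supportDim_le_ringKrullDim R X).trans hd.le)
        (length_le_supportDim_of_isRegular hreg)
    have hdepth : moduleDepth R X = rs.length := by
      refine le_antisymm (iSup_le fun ss => ?_) (length_le_moduleDepth hrs hreg)
      have := length_le_supportDim_of_isRegular ss.2.2
      rw [hdim] at this
      exact_mod_cast this
    exact
      { nontrivial := inferInstance
        finite := inferInstance
        depth_eq := by rw [hdepth, hdim]; rfl
        dim_eq := by rw [hdim, hd] }

namespace IsMaximalCohenMacaulay

variable [IsNoetherianRing R] {d : ℕ} (hd : ringKrullDim R = d)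

include hd

lemma congr (hX : IsMaximalCohenMacaulay R X) (e : X ≃ₗ[R] Y) : IsMaximalCohenMacaulay R Y := by
  have := hX.finite
  have := hX.nontrivial
  have := Module.Finite.equiv e
  have := e.symm.toEquiv.nontrivial
  rw [isMaximalCohenMacaulay_iff_exists_isWeaklyRegular hd] at hX ⊢
  simpa only [← e.isWeaklyRegular_congr] using hX

lemma hom [Module.Finite R X] [Nontrivial (X →ₗ[R] Y)] (hY : IsMaximalCohenMacaulay R Y)
    (hXY : ∀ j, 1 ≤ j → j < d → Subsingleton (ExtModule R X Y j)) :
    IsMaximalCohenMacaulay R (X →ₗ[R] Y) := by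
  have := hY.finite
  have := hY.nontrivial
  rw [isMaximalCohenMacaulay_iff_exists_isWeaklyRegular hd] at hY ⊢
  obtain ⟨rs, rfl, hrs, hreg⟩ := hY
  exact ⟨rs, rfl, hrs, isWeaklyRegular_hom hreg hXY⟩

lemma subsingleton_ext [Module.Finite R Y] (hX : IsMaximalCohenMacaulay R X)
    (hY : ExtVanishesAbove R Y d) (p : ℕ) : Subsingleton (ExtModule R X Y (p + 1)) := by
  have := hX.finite
  have := hX.nontrivial
  rw [isMaximalCohenMacaulay_iff_exists_isWeaklyRegular hd] at hX
  obtain ⟨rs, rfl, hrs, hreg⟩ := hX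
  exact hY.subsingleton_of_isWeaklyRegular hrs hreg (by lia)

lemma subsingleton_ext_residueField (hX : IsMaximalCohenMacaulay R X) {i : ℕ} (hi : i < d) :
    Subsingleton (ExtModule R (ResidueField R) X i) := by
  have := hX.finite
  have := hX.nontrivial
  obtain ⟨rs, rfl, hrs, hreg⟩ := exists_isRegular_of_moduleDepth_eq (hX.moduleDepth_eq hd)
  exact subsingleton_ext_residueField_of_isRegular hrs hreg hi

end IsMaximalCohenMacaulay

end MaximalCohenMacaulay

section TensorOverLocalRing

open IsLocalRing

variable [IsLocalRing R]

lemma nontrivial_residueField_tensorProduct (M : Type*) [AddCommGroup M] [Module R M]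
    [Module.Finite R M] [Nontrivial M] : Nontrivial (ResidueField R ⊗[R] M) := by
  rw [← not_subsingleton_iff_nontrivial, IsLocalRing.subsingleton_tensorProduct]
  exact not_subsingleton M

lemma nontrivial_tensorProduct_of_isLocalRing (M N : Type*) [AddCommGroup M] [Module R M]
    [Module.Finite R M] [Nontrivial M] [AddCommGroup N] [Module R N] [Module.Finite R N]
    [Nontrivial N] : Nontrivial (M ⊗[R] N) := by
  have := nontrivial_residueField_tensorProduct (R := R) M
  have := nontrivial_residueField_tensorProduct (R := R) N
  have : Nontrivial ((ResidueField R ⊗[R] M) ⊗[ResidueField R] (ResidueField R ⊗[R] N)) :=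
    (Module.FaithfullyFlat.nontrivial_tensorProduct_iff_right _ _).mpr ‹_›
  have : Nontrivial (ResidueField R ⊗[R] (M ⊗[R] N)) :=
    (TensorProduct.AlgebraTensorModule.distribBaseChange R (ResidueField R) M N).nontrivial
  by_contra h
  rw [not_nontrivial_iff_subsingleton] at h
  exact not_subsingleton (ResidueField R ⊗[R] (M ⊗[R] N)) inferInstance

lemma surjective_algebraMap_of_residueField_tensor_equiv {A : Type*} [Ring A] [Algebra R A]
    [Module.Finite R A] (e : ResidueField R ⊗[R] A ≃ₗ[R] ResidueField R) :
    Function.Surjective (algebraMap R A) := by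
  have : IsSimpleModule R (ResidueField R) :=
    isSimpleModule_iff_isCoatom.mpr (Ideal.isMaximal_def.mp inferInstance)
  have : IsSimpleModule R (ResidueField R ⊗[R] A) := IsSimpleModule.congr e
  have := IsSimpleModule.nontrivial R (ResidueField R ⊗[R] A)
  have map_range_eq_top : (LinearMap.range (Algebra.linearMap R A)).map
      (TensorProduct.mk R (ResidueField R) A 1) = ⊤ := by
    refine (eq_bot_or_eq_top _).resolve_left fun h => one_ne_zero (α := ResidueField R ⊗[R] A) ?_
    rw [← Submodule.mem_bot R, ← h]
    exact ⟨1, ⟨1, map_one (algebraMap R A)⟩, rfl⟩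
  exact LinearMap.range_eq_top.mp (map_tensorProduct_mk_eq_top.mp map_range_eq_top)

end TensorOverLocalRing

namespace IsCanonicalModule

open IsLocalRing

variable [IsLocalRing R] (hR : IsCohenMacaulayLocalRing R) {d : ℕ} (hd : ringKrullDim R = d)
  {ω : Type u} [AddCommGroup ω] [Module R ω] (hω : IsCanonicalModule R ω)

include hR hd hω

lemma extVanishesAbove : ExtVanishesAbove R ω d := by
  have := hR.noetherian
  have := hω.finite
  have depth_ring : moduleDepth R R = d := by
    have := hR.cohenMacaulay.depth_eq
    rw [Module.supportDim_self_eq_ringKrullDim, hd] at this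
    exact_mod_cast this
  exact extVanishesAbove_of_hasInjectiveDimensionLE depth_ring hω.finite_injectiveDimension

lemma subsingleton_ext {X : Type u} [AddCommGroup X] [Module R X]
    (hX : IsMaximalCohenMacaulay R X) (p : ℕ) : Subsingleton (ExtModule R X ω (p + 1)) := by
  have := hR.noetherian
  have := hω.finite
  exact hX.subsingleton_ext hd (hω.extVanishesAbove hR hd) p

lemma isMaximalCohenMacaulay_dual {X : Type u} [AddCommGroup X] [Module R X]
    [Nontrivial (X →ₗ[R] ω)] (hX : IsMaximalCohenMacaulay R X) :
    IsMaximalCohenMacaulay R (X →ₗ[R] ω) := by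
  have := hR.noetherian
  have := hX.finite
  refine hω.toIsMaximalCohenMacaulay.hom hd fun j hj _ => ?_
  obtain ⟨p, rfl⟩ := Nat.exists_eq_add_of_le' hj
  exact hω.subsingleton_ext hR hd hX p

lemma nonempty_residueField_tensor_end_equiv :
    Nonempty (ResidueField R ⊗[R] Module.End R ω ≃ₗ[R] ResidueField R) := by
  have := hR.noetherian
  have := hω.finite
  have hω' := hω.toIsMaximalCohenMacaulay
  obtain ⟨t, ht, ⟨type_one⟩⟩ := hω.type_one
  obtain rfl : t = d := by exact_mod_cast ht.symm.trans (hω'.moduleDepth_eq hd)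
  obtain ⟨duality⟩ := nonempty_tor_hom_equiv_ext_ext (M := ResidueField R)
    (hω.extVanishesAbove hR hd) (hω.subsingleton_ext hR hd hω') (zero_add t).symm
    fun j _ hj => hω'.subsingleton_ext_residueField hd hj
  exact ⟨(torZeroEquiv _ _).symm.trans (duality.trans ((congrLeft type_one t).trans type_one))⟩

lemma surjective_algebraMap_end : Function.Surjective (algebraMap R (Module.End R ω)) := by
  have := hR.noetherian
  have := hω.finite
  obtain ⟨e⟩ := hω.nonempty_residueField_tensor_end_equiv hR hd
  exact surjective_algebraMap_of_residueField_tensor_equiv e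

lemma subsingleton_ext_ker_algebraMap_end (p : ℕ) :
    Subsingleton
      (ExtModule R (LinearMap.ker (Algebra.linearMap R (Module.End R ω))) ω (p + 1)) := by
  have := hω.nontrivial
  have end_isMaximalCohenMacaulay :=
    hω.isMaximalCohenMacaulay_dual hR hd hω.toIsMaximalCohenMacaulay
  have := hω.subsingleton_ext hR hd end_isMaximalCohenMacaulay (p + 1)
  have := subsingleton_of_projective (A := R) (Y := ω) (R := R) (Nat.le_add_left 1 p)
  exact subsingleton_left (Submodule.subtype_injective _) (LinearMap.exact_subtype_ker_map _)
    (hω.surjective_algebraMap_end hR hd) (p + 1)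

lemma subsingleton_dual_ker_algebraMap_end :
    Subsingleton (LinearMap.ker (Algebra.linearMap R (Module.End R ω)) →ₗ[R] ω) := by
  have := hω.nontrivial
  have end_isMaximalCohenMacaulay :=
    hω.isMaximalCohenMacaulay_dual hR hd hω.toIsMaximalCohenMacaulay
  have := hω.subsingleton_ext hR hd end_isMaximalCohenMacaulay 0
  refine subsingleton_of_forall_eq 0 fun φ => ?_
  obtain ⟨ψ, rfl⟩ := lcomp_surjective_of_subsingleton_ext (Submodule.subtype_injective _)
    (LinearMap.exact_subtype_ker_map _) (hω.surjective_algebraMap_end hR hd) ω φ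
  ext ⟨r, hr⟩
  have smul_eq_zero (y : ω) : r • y = 0 := LinearMap.congr_fun (LinearMap.mem_ker.mp hr) y
  change ψ r = 0
  rw [← mul_one r, ← smul_eq_mul, map_smul, smul_eq_zero]

lemma injective_algebraMap_end : Function.Injective (algebraMap R (Module.End R ω)) := by
  have := hR.noetherian
  have := hω.finite
  have := hω.nontrivial
  set I := LinearMap.ker (Algebra.linearMap R (Module.End R ω))
  have := hω.subsingleton_dual_ker_algebraMap_end hR hd
  obtain ⟨duality⟩ := nonempty_tensor_hom_equiv_hom_hom (M := I) (hω.extVanishesAbove hR hd)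
    (hω.subsingleton_ext hR hd hω.toIsMaximalCohenMacaulay) fun j hj _ => by
      obtain ⟨p, rfl⟩ := Nat.exists_eq_add_of_le' hj
      exact hω.subsingleton_ext_ker_algebraMap_end hR hd p
  have tensor_subsingleton : Subsingleton (I ⊗[R] (ω →ₗ[R] ω)) := duality.toEquiv.subsingleton
  refine LinearMap.ker_eq_bot.mp (by_contra fun hbot : I ≠ ⊥ => ?_)
  have := Submodule.nontrivial_iff_ne_bot.mpr hbot
  have := nontrivial_tensorProduct_of_isLocalRing (R := R) I (ω →ₗ[R] ω)
  exact not_subsingleton _ tensor_subsingleton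

theorem nonempty_end_equiv : Nonempty (R ≃ₗ[R] Module.End R ω) :=
  ⟨LinearEquiv.ofBijective (Algebra.linearMap R (Module.End R ω))
    ⟨hω.injective_algebraMap_end hR hd, hω.surjective_algebraMap_end hR hd⟩⟩

theorem nonempty_bidual_equiv {N : Type u} [AddCommGroup N] [Module R N]
    (hN : IsMaximalCohenMacaulay R N) : Nonempty (((N →ₗ[R] ω) →ₗ[R] ω) ≃ₗ[R] N) := by
  have := hR.noetherian
  have := hω.finite
  have := hN.finite
  obtain ⟨homothety⟩ := hω.nonempty_end_equiv hR hd
  obtain ⟨duality⟩ := nonempty_tensor_hom_equiv_hom_hom (M := N) (hω.extVanishesAbove hR hd)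
    (hω.subsingleton_ext hR hd hω.toIsMaximalCohenMacaulay) fun j hj _ => by
      obtain ⟨p, rfl⟩ := Nat.exists_eq_add_of_le' hj
      exact hω.subsingleton_ext hR hd hN p
  exact ⟨duality.symm.trans <| (homothety.symm.lTensor N).trans (TensorProduct.rid R N)⟩

variable {M N : Type u} [AddCommGroup M] [Module R M] [AddCommGroup N] [Module R N]
  (hN : IsMaximalCohenMacaulay R N)

include hN

lemma nontrivial_dual : Nontrivial (N →ₗ[R] ω) := by
  have := hN.nontrivial
  obtain ⟨biduality⟩ := hω.nonempty_bidual_equiv hR hd hN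
  by_contra h
  rw [not_nontrivial_iff_subsingleton] at h
  exact not_subsingleton N biduality.symm.toEquiv.subsingleton

variable [Module.Finite R M]

theorem nonempty_tensor_dual_equiv_dual_hom
    (hMN : ∀ j, 1 ≤ j → j ≤ d → Subsingleton (ExtModule R M N j)) :
    Nonempty ((M ⊗[R] (N →ₗ[R] ω)) ≃ₗ[R] ((M →ₗ[R] N) →ₗ[R] ω)) := by
  have := hR.noetherian
  have := hN.finite
  exact nonempty_tensor_hom_equiv_hom_hom (hω.extVanishesAbove hR hd)
    (hω.subsingleton_ext hR hd hN) hMN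

theorem isMaximalCohenMacaulay_tensor_dual_and_hom [Nontrivial M]
    (hMN : ∀ j, 1 ≤ j → j ≤ d → Subsingleton (ExtModule R M N j)) :
    IsMaximalCohenMacaulay R (M ⊗[R] (N →ₗ[R] ω)) ∧ IsMaximalCohenMacaulay R (M →ₗ[R] N) := by
  have := hR.noetherian
  have := hω.finite
  have := hN.finite
  have := hω.nontrivial_dual hR hd hN
  have := nontrivial_tensorProduct_of_isLocalRing (R := R) M (N →ₗ[R] ω)
  obtain ⟨duality⟩ := hω.nonempty_tensor_dual_equiv_dual_hom hR hd hN hMN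
  have dual_hom_nontrivial := duality.symm.toEquiv.nontrivial
  have hom_nontrivial : Nontrivial (M →ₗ[R] N) := by
    by_contra h
    rw [not_nontrivial_iff_subsingleton] at h
    exact not_subsingleton ((M →ₗ[R] N) →ₗ[R] ω) inferInstance
  have hom_isMaximalCohenMacaulay : IsMaximalCohenMacaulay R (M →ₗ[R] N) :=
    hN.hom hd fun j h₁ h₂ => hMN j h₁ h₂.le
  exact ⟨(hω.isMaximalCohenMacaulay_dual hR hd hom_isMaximalCohenMacaulay).congr hd duality.symm,
    hom_isMaximalCohenMacaulay⟩

end IsCanonicalModule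

end

theorem mainTheorem1 {R : Type u} [CommRing R] [IsLocalRing R]
    (hR : IsCohenMacaulayLocalRing R) (d : ℕ) (hd : ringKrullDim R = d)
    {ω : Type u} [AddCommGroup ω] [Module R ω] (hω : IsCanonicalModule R ω)
    {M N : Type u} [AddCommGroup M] [Module R M] [Module.Finite R M]
    [AddCommGroup N] [Module R N] (hN : IsMaximalCohenMacaulay R N) (n : ℕ) :
    -- (i)
    ((∀ j : ℕ, 1 ≤ j → j ≤ d → Subsingleton (ExtModule R M N j)) →
      Nonempty ((M ⊗[R] CanonicalDual R ω N) ≃ₗ[R] CanonicalDual R ω (M →ₗ[R] N)) ∧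
      (Nontrivial M →
        IsMaximalCohenMacaulay R (M ⊗[R] CanonicalDual R ω N) ∧
        IsMaximalCohenMacaulay R (M →ₗ[R] N))) ∧
    -- (ii)
    ((∀ j : ℕ, 1 ≤ j → j ≤ d + n → Subsingleton (ExtModule R M N j)) →
      Nonempty (ExtModule R (ExtModule R M N (d + n + 1)) ω d ≃ₗ[R]
        TorModule R M (CanonicalDual R ω N) (n + 1)) ∧
      (∀ i : ℕ, 1 ≤ i → i ≤ n → Subsingleton (TorModule R M (CanonicalDual R ω N) i)) ∧
      ∃ (f₁ : TorModule R M (CanonicalDual R ω N) (n + 3) →ₗ[R]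
            extInt R (ExtModule R M N (d + n + 1)) ω ((d : ℤ) - 2))
        (f₂ : extInt R (ExtModule R M N (d + n + 1)) ω ((d : ℤ) - 2) →ₗ[R]
            ExtModule R (ExtModule R M N (d + n + 2)) ω d)
        (f₃ : ExtModule R (ExtModule R M N (d + n + 2)) ω d →ₗ[R]
            TorModule R M (CanonicalDual R ω N) (n + 2))
        (f₄ : TorModule R M (CanonicalDual R ω N) (n + 2) →ₗ[R]
            extInt R (ExtModule R M N (d + n + 1)) ω ((d : ℤ) - 1)),
        Function.Exact f₁ f₂ ∧ Function.Exact f₂ f₃ ∧ Function.Exact f₃ f₄ ∧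
          Function.Surjective f₄) ∧
    -- (iii)
    ((∀ j : ℕ, 1 ≤ j → j ≤ d + n → Subsingleton (TorModule R M (CanonicalDual R ω N) j)) →
      Nonempty (CanonicalDual R ω (TorModule R M (CanonicalDual R ω N) (d + n + 1)) ≃ₗ[R]
        ExtModule R M N (d + n + 1)) ∧
      (∀ i : ℕ, i ≤ d →
        Nonempty (ExtModule R (M ⊗[R] CanonicalDual R ω N) ω i ≃ₗ[R] ExtModule R M N i)) ∧
      (∀ k : ℕ, d + 1 ≤ k → k ≤ d + n → Subsingleton (ExtModule R M N k)) ∧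
      ∃ (g₁ : ExtModule R (TorModule R M (CanonicalDual R ω N) (d + n + 1)) ω 1 →ₗ[R]
            ExtModule R M N (d + n + 2))
        (g₂ : ExtModule R M N (d + n + 2) →ₗ[R]
            CanonicalDual R ω (TorModule R M (CanonicalDual R ω N) (d + n + 2)))
        (g₃ : CanonicalDual R ω (TorModule R M (CanonicalDual R ω N) (d + n + 2)) →ₗ[R]
            ExtModule R (TorModule R M (CanonicalDual R ω N) (d + n + 1)) ω 2)
        (g₄ : ExtModule R (TorModule R M (CanonicalDual R ω N) (d + n + 1)) ω 2 →ₗ[R]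
            ExtModule R M N (d + n + 3)),
        Function.Injective g₁ ∧ Function.Exact g₁ g₂ ∧ Function.Exact g₂ g₃ ∧
          Function.Exact g₃ g₄) := by
  have := hR.noetherian
  have := hω.finite
  have := hN.finite
  have := hω.nontrivial_dual hR hd hN
  have hω' := hω.extVanishesAbove hR hd
  have hNω := hω.subsingleton_ext hR hd hN
  have hNω' := hω.subsingleton_ext hR hd (hω.isMaximalCohenMacaulay_dual hR hd hN)
  obtain ⟨biduality⟩ := hω.nonempty_bidual_equiv hR hd hN
  refine ⟨fun hExt => ⟨?_, fun _ => ?_⟩, fun hExt => ⟨?_, fun i h₁ h₂ => ?_, ?_⟩,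
    fun hTor => ⟨?_, fun i hi => ?_, fun k h₁ h₂ => ?_, ?_⟩⟩
  · exact hω.nonempty_tensor_dual_equiv_dual_hom hR hd hN hExt
  · exact hω.isMaximalCohenMacaulay_tensor_dual_and_hom hR hd hN hExt
  · exact (nonempty_tor_hom_equiv_ext_ext hω' hNω (by lia)
      fun j h₁ h₂ => hExt j (by lia) (by lia)).map .symm
  · exact subsingleton_tor_hom hω' hNω fun j h₃ h₄ => hExt j (by lia) (by lia)
  · exact existsExactSeqToZero_tor_hom hω' hNω (by lia) fun j h₁ h₂ => hExt j (by lia) (by lia)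
  · exact (nonempty_hom_tor_equiv_ext_hom hNω' hω' hTor (by lia)).map
      (.trans · (ExtModule.congrRight biduality _))
  · exact (nonempty_ext_tensor_equiv_ext_hom hNω' fun j h₁ h₂ => hTor j h₁ (by lia)).map
      (.trans · (ExtModule.congrRight biduality _))
  · have := subsingleton_ext_hom hNω' hω' hTor h₁ h₂
    exact (ExtModule.congrRight biduality k).symm.toEquiv.subsingleton
  · exact (existsExactSeqFromZero_ext_hom hNω' hω' hTor (by lia)).congr (.refl R _)
      (ExtModule.congrRight biduality _) (.refl R _) (.refl R _) (ExtModule.congrRight biduality _)
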